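/- For $1\le p\le q<\infty$ and a measurable function $f:\mathbb R^n\to\mathbb C$ let $$\|f\|_{\mathcal M^p_q}:=\sup_{a\in\mathbb R^n,\ r>0}|B(a,r)|^{\frac1q-\frac1p}\Bigl(\int_{B(a,r)}|f(y)|^p\,dy\Bigr)^{\frac1p}\in[0,\infty]$$ be the Morrey norm, and for $g\in C_c^\infty(\mathbb R^n)$ and $\gamma>0$ let $(-\Delta)^{\gamma/2}g$ be the function whose Fourier transform is $|\xi|^\gamma\widehat g(\xi)$, where $\widehat g(\xi)=\int_{\mathbb R^n}g(x)e^{-ix\cdot\xi}\,dx$; that is, $(-\Delta)^{\gamma/2}g(x)=(2\pi)^{-n}\int_{\mathbb R^n}|\xi|^\gamma\widehat g(\xi)e^{ix\cdot\xi}\,d\xi$. **Theorem 3.4.** Let $1<p\le q<\infty$, $1\le p_2\le q_2<\infty$, $\beta>0$ and $0<\gamma<\frac nq$. Let $p_0,q_0$ be determined by $$\frac{\beta+\gamma}{p_0}=\frac{\beta}{p}+\frac{\gamma}{p_2},\qquad \frac{\beta+\gamma}{q_0}=\frac{\beta}{q}+\frac{\gamma}{q_2}.$$ Then there is a finite constant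 $C$, depending only on $n,p,q,p_2,q_2,\beta,\gamma$, such that $$\|g\|_{\mathcal M^{p_0}_{q_0}}\le C\,\bigl\||\cdot|^{\beta}g\bigr\|_{\mathcal M^{p_2}_{q_2}}^{\gamma/(\beta+\gamma)}\,\bigl\|(-\Delta)^{\gamma/2}g\bigr\|_{\mathcal M^{p}_{q}}^{\beta/(\beta+\gamma)}$$ for every $g\in C_c^\infty(\mathbb R^n)$ (complex-valued). -/

import Mathlib

open MeasureTheory
open scoped ENNReal NNReal ContDiff RealInnerProductSpace

noncomputable section

/-- The Morrey norm `sup_{a, r > 0} |B(a,r)|^(1/q - 1/p) (∫_{B(a,r)} |f|^p)^(1/p)` of a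
complex-valued function on `ℝⁿ`, as an extended nonnegative real number. -/
def morreyNorm {n : ℕ} (p q : ℝ) (f : EuclideanSpace ℝ (Fin n) → ℂ) : ℝ≥0∞ :=
  ⨆ (a : EuclideanSpace ℝ (Fin n)) (r : ℝ) (_ : 0 < r),
    volume (Metric.ball a r) ^ (1 / q - 1 / p) *
      (∫⁻ y in Metric.ball a r, ‖f y‖ₑ ^ p) ^ (1 / p)

/-- The Fourier transform `∫ f(x) e^{-i x·ξ} dx`. -/
def fourierHat {n : ℕ} (f : EuclideanSpace ℝ (Fin n) → ℂ) (ξ : EuclideanSpace ℝ (Fin n)) : ℂ :=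
  ∫ x, f x * Complex.exp (-Complex.I * (⟪x, ξ⟫ : ℝ))

/-- The inverse Fourier transform `(2π)^{-n} ∫ F(ξ) e^{i x·ξ} dξ`. -/
def fourierHatInv {n : ℕ} (F : EuclideanSpace ℝ (Fin n) → ℂ) (x : EuclideanSpace ℝ (Fin n)) : ℂ :=
  ((2 * Real.pi : ℝ) : ℂ)⁻¹ ^ n * ∫ ξ, F ξ * Complex.exp (Complex.I * (⟪x, ξ⟫ : ℝ))

/-- The fractional power `(-Δ)^{s/2}` of the Laplacian, that is, the Fourier multiplier with
symbol `|ξ|^s`. For `s ≥ 0` and `g` smooth with compact support, `|ξ|^s ĝ(ξ)` is continuous off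
the origin and rapidly decreasing, so the integrals converge. -/
def fracLaplacian {n : ℕ} (s : ℝ) (g : EuclideanSpace ℝ (Fin n) → ℂ) :
    EuclideanSpace ℝ (Fin n) → ℂ :=
  fourierHatInv fun ξ => ((‖ξ‖ ^ s : ℝ) : ℂ) * fourierHat g ξ

end

/-!
The inequality is Hölder's inequality in Morrey spaces applied to the factorization
`|g| = (|x|^β |g|)^θ * (|x|^{-γ} |g|)^{1-θ}` with `θ = γ / (β + γ)`
(`morreyNorm_le_mul_of_enorm_le`), followed by Hardy's inequality
`‖|x|^{-γ} g‖ ≤ C ‖(-Δ)^{γ/2} g‖` in the Morrey space with exponents `p, q`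
(`exists_hardy_morreyNorm_le`).

Hardy's inequality starts from the pointwise bound of `g` by the Riesz potential of
`f = |(-Δ)^{γ/2} g|` (`exists_enorm_le_riesz`). It comes from writing `|ξ|^{-γ}` as a superposition
of Gaussians: each Gaussian average of `(-Δ)^{γ/2} g` can be computed by Fubini's theorem from
`|ξ|^γ ĝ ∈ L¹` alone, so the decay of `(-Δ)^{γ/2} g` at infinity never has to be studied.

The weighted potential `|x|^{-γ} ∫ |x - y|^{γ-n} f(y) dy` is then cut at `|x - y| = |x| / 2`.

* Near the diagonal the substitution `y = x + |x| z` turns it into an average over `|z| < 1/2` of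
  the functions `x ↦ f(x + |x| z)`. The maps `x ↦ x + |x| z` are bi-Lipschitz uniformly in `z`, so
  composition with them preserves the Morrey bound, and no maximal function is needed
  (`exists_near_bound`).
* Away from the diagonal the potential is dominated by
  `|x|^{-γ} ∫ max(|x|, |y|)^{γ-n} f(y) dy` (`farPotential`), which is radially decreasing;
  hence only balls at the origin matter (`lintegral_ball_le_of_anti`). On `B(0, r)`, the contribution of
  `|y| < r` is handled in `L^p` by Schur's test (`exists_lintegral_farPotential_rpow_le`) and
  that of `|y| ≥ r` by a dyadic sum, which converges because `γ < n / q` (`exists_tail_bound`).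

In this part the Morrey condition is used in the form
`∫_{B(a,r)} f^p ≤ N r^κ` for all balls, with `κ = n (1 - p / q)`.
-/

open Set
open scoped FourierTransform

/-! ### Fourier inversion and Gaussian averages -/

section Fourier

variable {n : ℕ}

theorem fourierHat_eq_fourier (g : EuclideanSpace ℝ (Fin n) → ℂ) (ξ : EuclideanSpace ℝ (Fin n)) :
    fourierHat g ξ = 𝓕 g ((2 * Real.pi)⁻¹ • ξ) := by
  rw [fourierHat, Real.fourier_eq']
  refine integral_congr_ae (.of_forall fun x => ?_)
  simp only [smul_eq_mul, inner_smul_right]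
  rw [mul_comm]
  congr 2
  push_cast
  have : (Real.pi : ℂ) ≠ 0 := by exact_mod_cast Real.pi_ne_zero
  field_simp

theorem norm_cexp_I_mul_ofReal (r : ℝ) : ‖Complex.exp (Complex.I * (r : ℝ))‖ = 1 := by
  rw [mul_comm]; exact Complex.norm_exp_ofReal_mul_I r

theorem fourierHatInv_fourierHat {g : EuclideanSpace ℝ (Fin n) → ℂ} (hg : Continuous g)
    (hgi : Integrable g) (hfi : Integrable (𝓕 g)) (x : EuclideanSpace ℝ (Fin n)) :
    fourierHatInv (fourierHat g) x = g x := by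
  have h := congrFun (hg.fourierInv_fourier_eq hgi hfi) x
  rw [Real.fourierInv_eq'] at h
  rw [fourierHatInv, ← h]
  have hpi : (2 * Real.pi) ≠ 0 := by positivity
  have key := Measure.integral_comp_smul (volume : Measure (EuclideanSpace ℝ (Fin n)))
    (fun w => 𝓕 g w * Complex.exp (Complex.I * (⟪x, (2 * Real.pi) • w⟫ : ℝ))) (2 * Real.pi)⁻¹
  simp only [smul_smul, mul_inv_cancel₀ hpi, one_smul] at key
  simp_rw [fourierHat_eq_fourier]
  rw [key, finrank_euclideanSpace_fin, inv_pow (2 * Real.pi), inv_inv, abs_of_pos (by positivity),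
    Complex.real_smul, ← mul_assoc]
  have : ((2 * Real.pi : ℝ) : ℂ)⁻¹ ^ n * (((2 * Real.pi) ^ n : ℝ) : ℂ) = 1 := by
    rw [Complex.ofReal_pow, ← mul_pow, inv_mul_cancel₀ (by exact_mod_cast hpi), one_pow]
  rw [this, one_mul]
  refine integral_congr_ae (.of_forall fun w => ?_)
  simp only [smul_eq_mul, inner_smul_right, real_inner_comm x w]
  rw [mul_comm]
  congr 2
  push_cast
  ring

theorem continuous_fourierHatInv {F : EuclideanSpace ℝ (Fin n) → ℂ} (hF : Integrable F) :
    Continuous (fourierHatInv F) := by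
  unfold fourierHatInv
  refine continuous_const.mul (continuous_of_dominated (bound := fun ξ => ‖F ξ‖) ?_ ?_ hF.norm ?_)
  · intro x
    exact hF.aestronglyMeasurable.mul (by fun_prop : Continuous fun ξ =>
      Complex.exp (Complex.I * (⟪x, ξ⟫ : ℝ))).aestronglyMeasurable
  · intro x
    refine .of_forall fun ξ => ?_
    rw [norm_mul, norm_cexp_I_mul_ofReal, mul_one]
  · refine .of_forall fun ξ => ?_
    fun_prop

/-- The Gaussian integral behind the Fourier transform of a translated Gaussian. -/
theorem integral_gaussian_mul_cexp {s : ℝ} (hs : 0 < s) (x ξ : EuclideanSpace ℝ (Fin n)) :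
    ∫ y, ((Real.exp (-s * ‖x - y‖ ^ 2) : ℝ) : ℂ) * Complex.exp (Complex.I * (⟪y, ξ⟫ : ℝ)) =
      (((Real.pi / s) ^ ((n : ℝ) / 2) : ℝ) : ℂ) *
        (Complex.exp (Complex.I * (⟪x, ξ⟫ : ℝ)) *
          ((Real.exp (-(‖ξ‖ ^ 2 / (4 * s))) : ℝ) : ℂ)) := by
  have h1 := integral_sub_left_eq_self (μ := (volume : Measure (EuclideanSpace ℝ (Fin n))))
    (fun v => ((Real.exp (-s * ‖v‖ ^ 2) : ℝ) : ℂ) *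
      Complex.exp (Complex.I * (⟪x - v, ξ⟫ : ℝ))) x
  simp only [sub_sub_cancel] at h1
  rw [h1]
  have h2 := GaussianFourier.integral_cexp_neg_mul_sq_norm_add (V := EuclideanSpace ℝ (Fin n))
    (b := (s : ℂ)) (by simpa using hs) (-Complex.I) ξ
  have h3 : ∀ v : EuclideanSpace ℝ (Fin n), ((Real.exp (-s * ‖v‖ ^ 2) : ℝ) : ℂ) *
      Complex.exp (Complex.I * (⟪x - v, ξ⟫ : ℝ)) = Complex.exp (Complex.I * (⟪x, ξ⟫ : ℝ)) *
        Complex.exp (-(s : ℂ) * ‖v‖ ^ 2 + -Complex.I * (⟪ξ, v⟫ : ℝ)) := by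
    intro v
    rw [Complex.ofReal_exp, ← Complex.exp_add, ← Complex.exp_add, inner_sub_left,
      real_inner_comm v ξ]
    congr 1
    push_cast
    ring
  simp_rw [h3]
  rw [integral_const_mul, h2, finrank_euclideanSpace_fin]
  have h4 : ((Real.pi : ℂ) / (s : ℂ)) ^ ((n : ℂ) / 2) =
      (((Real.pi / s) ^ ((n : ℝ) / 2) : ℝ) : ℂ) := by
    rw [Complex.ofReal_cpow (by positivity)]
    push_cast
    rfl
  rw [h4, Complex.ofReal_exp]
  rw [mul_left_comm]
  congr 3
  push_cast
  rw [neg_sq, Complex.I_sq]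
  ring

theorem integrable_gaussian_sub {s : ℝ} (hs : 0 < s) (x : EuclideanSpace ℝ (Fin n)) :
    Integrable fun y : EuclideanSpace ℝ (Fin n) =>
      ((Real.exp (-s * ‖x - y‖ ^ 2) : ℝ) : ℂ) := by
  have h2 := GaussianFourier.integrable_cexp_neg_mul_sq_norm_add (V := EuclideanSpace ℝ (Fin n))
    (b := (s : ℂ)) (by simpa using hs) 0 0
  have h3 := h2.comp_sub_left x
  refine h3.congr (.of_forall fun y => ?_)
  simp

/-- Smoothing an inverse Fourier transform by a Gaussian damps its frequencies by the dual
Gaussian. Only `F ∈ L¹` is used, so no decay of the inverse transform is needed. -/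
theorem integral_gaussian_mul_fourierHatInv {F : EuclideanSpace ℝ (Fin n) → ℂ} (hF : Integrable F)
    {s : ℝ} (hs : 0 < s) (x : EuclideanSpace ℝ (Fin n)) :
    ∫ y, ((Real.exp (-s * ‖x - y‖ ^ 2) : ℝ) : ℂ) * fourierHatInv F y =
      ((2 * Real.pi : ℝ) : ℂ)⁻¹ ^ n * ((((Real.pi / s) ^ ((n : ℝ) / 2) : ℝ) : ℂ) *
        ∫ ξ, F ξ * Complex.exp (Complex.I * (⟪x, ξ⟫ : ℝ)) *
          ((Real.exp (-(‖ξ‖ ^ 2 / (4 * s))) : ℝ) : ℂ)) := by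
  have hswap : Integrable (Function.uncurry fun y ξ : EuclideanSpace ℝ (Fin n) =>
      ((Real.exp (-s * ‖x - y‖ ^ 2) : ℝ) : ℂ) * (F ξ * Complex.exp (Complex.I * (⟪y, ξ⟫ : ℝ))))
      (volume.prod volume) := by
    have h := ((integrable_gaussian_sub hs x).mul_prod hF)
    refine h.mono ?_ (.of_forall fun z => ?_)
    · have h5 : AEStronglyMeasurable (fun z : EuclideanSpace ℝ (Fin n) × EuclideanSpace ℝ (Fin n)
        => Complex.exp (Complex.I * (⟪z.1, z.2⟫ : ℝ))) (volume.prod volume) :=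
        (by fun_prop : Continuous _).aestronglyMeasurable
      refine (h.aestronglyMeasurable.mul h5).congr (.of_forall fun z => ?_)
      simp only [Function.uncurry, Pi.mul_apply]
      ring
    · simp only [Function.uncurry, norm_mul, norm_cexp_I_mul_ofReal, mul_one]
      exact le_rfl
  simp only [fourierHatInv]
  simp_rw [mul_left_comm _ (((2 * Real.pi : ℝ) : ℂ)⁻¹ ^ n)]
  rw [integral_const_mul]
  congr 1
  simp_rw [← integral_const_mul]
  rw [integral_integral_swap hswap]
  refine integral_congr_ae (.of_forall fun ξ => ?_)
  simp only
  simp_rw [mul_left_comm _ (F ξ)]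
  rw [integral_const_mul, integral_gaussian_mul_cexp hs x ξ]
  ring

end Fourier

/-! ### Gamma integrals -/

section Subordination

theorem integrableOn_of_integral_pos {φ : ℝ → ℝ} {s : Set ℝ} (h : 0 < ∫ t in s, φ t) :
    IntegrableOn φ s := by
  by_contra hn
  rw [integral_undef hn] at h
  exact h.false

/-- The superposition of Gaussians that represents `ρ ^ (-γ)`; the Gamma integral after the
substitution `s ↦ 1 / s`. -/
theorem integral_rpow_mul_exp_neg_div {γ ρ : ℝ} (hγ : 0 < γ) (hρ : 0 < ρ) :
    ∫ s in Ioi (0 : ℝ), s ^ (-(γ / 2) - 1) * Real.exp (-(ρ ^ 2 / (4 * s))) =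
      4 ^ (γ / 2) * Real.Gamma (γ / 2) * ρ ^ (-γ) := by
  have hval := Real.integral_rpow_mul_exp_neg_mul_Ioi (a := γ / 2) (r := ρ ^ 2 / 4)
    (by positivity) (by positivity)
  have hsub := integral_comp_rpow_Ioi
    (fun t : ℝ => t ^ (γ / 2 - 1) * Real.exp (-(ρ ^ 2 / 4 * t))) (p := -1) (by norm_num)
  rw [hval] at hsub
  have hconst : (1 / (ρ ^ 2 / 4)) ^ (γ / 2) * Real.Gamma (γ / 2) =
      4 ^ (γ / 2) * Real.Gamma (γ / 2) * ρ ^ (-γ) := by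
    rw [one_div_div, Real.div_rpow (by norm_num) (by positivity), ← Real.rpow_natCast ρ 2,
      ← Real.rpow_mul hρ.le, Real.rpow_neg hρ.le]
    have : ((2 : ℕ) : ℝ) * (γ / 2) = γ := by push_cast; ring
    rw [this]
    ring
  rw [← hconst, ← hsub]
  refine setIntegral_congr_fun measurableSet_Ioi fun s (hs : 0 < s) => ?_
  simp only [smul_eq_mul, abs_neg, abs_one, one_mul]
  rw [← Real.rpow_mul hs.le, ← mul_assoc, ← Real.rpow_add hs, Real.rpow_neg_one]
  congr 2
  · ring
  · field_simp

theorem lintegral_rpow_mul_exp_neg_mul {a r : ℝ} (ha : 0 < a) (hr : 0 < r) :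
    ∫⁻ s in Ioi (0 : ℝ), ENNReal.ofReal (s ^ (a - 1) * Real.exp (-(r * s))) =
      ENNReal.ofReal ((1 / r) ^ a * Real.Gamma a) := by
  have hval := Real.integral_rpow_mul_exp_neg_mul_Ioi ha hr
  have hΓ := Real.Gamma_pos_of_pos ha
  rw [← hval, ofReal_integral_eq_lintegral_ofReal]
  · exact integrableOn_of_integral_pos (by rw [hval]; positivity)
  · filter_upwards [ae_restrict_mem measurableSet_Ioi] with s hs
    have : (0 : ℝ) < s := hs
    simp only [Pi.zero_apply]
    positivity

end Subordination

/-! ### Bound by the Riesz potential -/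

section Potential

variable {n : ℕ}

/-- Subordination: `|ξ|^{-γ}` is a superposition of Gaussians, so a function `g` is recovered
from `(-Δ)^{γ/2} g` by superposing its Gaussian averages. -/
theorem subordination_formula {γ : ℝ} (hγ : 0 < γ) (hn : 0 < n)
    {G : EuclideanSpace ℝ (Fin n) → ℂ} (hG : Integrable G)
    (hF : Integrable fun ξ => ((‖ξ‖ ^ γ : ℝ) : ℂ) * G ξ) (x : EuclideanSpace ℝ (Fin n)) :
    ((4 ^ (γ / 2) * Real.Gamma (γ / 2) : ℝ) : ℂ) * fourierHatInv G x =
      ∫ s in Ioi (0 : ℝ),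
        ((s ^ (-(γ / 2) - 1) * ((Real.pi / s) ^ ((n : ℝ) / 2))⁻¹ : ℝ) : ℂ) *
        ∫ y, ((Real.exp (-s * ‖x - y‖ ^ 2) : ℝ) : ℂ) *
          fourierHatInv (fun ξ => ((‖ξ‖ ^ γ : ℝ) : ℂ) * G ξ) y := by
  have : Nonempty (Fin n) := ⟨⟨0, hn⟩⟩
  set F : EuclideanSpace ℝ (Fin n) → ℂ := fun ξ => ((‖ξ‖ ^ γ : ℝ) : ℂ) * G ξ with hFdef
  set c : ℝ := 4 ^ (γ / 2) * Real.Gamma (γ / 2) with hc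
  have hcpos : 0 < c := mul_pos (by positivity) (Real.Gamma_pos_of_pos (by positivity))
  set k : EuclideanSpace ℝ (Fin n) → ℝ → ℝ := fun ξ s =>
    s ^ (-(γ / 2) - 1) * Real.exp (-(‖ξ‖ ^ 2 / (4 * s))) with hk
  have hkint : ∀ ξ : EuclideanSpace ℝ (Fin n), ξ ≠ 0 →
      ∫ s in Ioi (0 : ℝ), k ξ s = c * ‖ξ‖ ^ (-γ) := fun ξ hξ =>
    integral_rpow_mul_exp_neg_div hγ (norm_pos_iff.2 hξ)
  have hkI : ∀ ξ : EuclideanSpace ℝ (Fin n), ξ ≠ 0 → IntegrableOn (k ξ) (Ioi 0) := fun ξ hξ =>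
    integrableOn_of_integral_pos (by
      have := norm_pos_iff.2 hξ
      rw [hkint ξ hξ]; positivity)
  have hne : ∀ᵐ ξ : EuclideanSpace ℝ (Fin n), ξ ≠ 0 := by
    simp [ae_iff, measure_singleton]
  have hmeas : AEStronglyMeasurable (Function.uncurry fun (ξ : EuclideanSpace ℝ (Fin n)) (s : ℝ) =>
      F ξ * Complex.exp (Complex.I * (⟪x, ξ⟫ : ℝ)) * (k ξ s : ℂ))
      (volume.prod (volume.restrict (Ioi 0))) := by
    refine AEStronglyMeasurable.mul (AEStronglyMeasurable.mul ?_ ?_) ?_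
    · exact hF.aestronglyMeasurable.comp_fst
    · exact (by fun_prop : Continuous fun z : EuclideanSpace ℝ (Fin n) × ℝ =>
        Complex.exp (Complex.I * (⟪x, z.1⟫ : ℝ))).aestronglyMeasurable
    · refine Measurable.aestronglyMeasurable ?_
      simp only [hk]
      fun_prop
  have hint : Integrable (Function.uncurry fun (ξ : EuclideanSpace ℝ (Fin n)) (s : ℝ) =>
      F ξ * Complex.exp (Complex.I * (⟪x, ξ⟫ : ℝ)) * (k ξ s : ℂ))
      (volume.prod (volume.restrict (Ioi 0))) := by
    rw [integrable_prod_iff hmeas]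
    constructor
    · filter_upwards [hne] with ξ hξ
      exact (Integrable.ofReal (𝕜 := ℂ) (hkI ξ hξ)).const_mul
        (F ξ * Complex.exp (Complex.I * (⟪x, ξ⟫ : ℝ)))
    · refine (hG.norm.const_mul c).congr ?_
      filter_upwards [hne] with ξ hξ
      have hρ := norm_pos_iff.2 hξ
      simp only [Function.uncurry, norm_mul, norm_cexp_I_mul_ofReal, mul_one, Complex.norm_real]
      rw [integral_const_mul]
      have : ∫ s in Ioi (0 : ℝ), ‖k ξ s‖ = ∫ s in Ioi (0 : ℝ), k ξ s := by
        refine setIntegral_congr_fun measurableSet_Ioi fun s (hs : 0 < s) => ?_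
        simp only [hk]
        exact Real.norm_of_nonneg (by positivity)
      rw [this, hkint ξ hξ, hFdef]
      simp only [norm_mul, Complex.norm_real]
      rw [Real.norm_of_nonneg (by positivity), Real.rpow_neg hρ.le]
      field_simp
  have hswap := integral_integral_swap hint
  have hleft : ∫ ξ, ∫ s in Ioi (0 : ℝ), F ξ * Complex.exp (Complex.I * (⟪x, ξ⟫ : ℝ)) * (k ξ s : ℂ)
      = (c : ℂ) * ∫ ξ, G ξ * Complex.exp (Complex.I * (⟪x, ξ⟫ : ℝ)) := by
    rw [← integral_const_mul]
    refine integral_congr_ae ?_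
    filter_upwards [hne] with ξ hξ
    have hρ := norm_pos_iff.2 hξ
    rw [integral_const_mul, integral_complex_ofReal, hkint ξ hξ, hFdef]
    have : ((‖ξ‖ ^ γ : ℝ) : ℂ) * ((‖ξ‖ ^ (-γ) : ℝ) : ℂ) = 1 := by
      rw [← Complex.ofReal_mul, ← Real.rpow_add hρ]; simp
    push_cast at this ⊢
    linear_combination (c * G ξ * Complex.exp (Complex.I * (⟪x, ξ⟫ : ℝ))) * this
  rw [fourierHatInv, mul_left_comm, ← hleft, hswap, ← integral_const_mul]
  refine setIntegral_congr_fun measurableSet_Ioi fun s (hs : 0 < s) => ?_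
  rw [integral_gaussian_mul_fourierHatInv hF hs x]
  have hpos : (0 : ℝ) < (Real.pi / s) ^ ((n : ℝ) / 2) := by positivity
  have hkc : ∀ ξ, F ξ * Complex.exp (Complex.I * (⟪x, ξ⟫ : ℝ)) * (k ξ s : ℂ) =
      ((s ^ (-(γ / 2) - 1) : ℝ) : ℂ) * (F ξ * Complex.exp (Complex.I * (⟪x, ξ⟫ : ℝ)) *
          ((Real.exp (-(‖ξ‖ ^ 2 / (4 * s))) : ℝ) : ℂ)) := by
    intro ξ
    simp only [hk]
    rw [Complex.ofReal_mul]
    ring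
  simp_rw [hkc]
  rw [integral_const_mul, Complex.ofReal_mul (s ^ (-(γ / 2) - 1)), Complex.ofReal_inv]
  have : (((Real.pi / s) ^ ((n : ℝ) / 2) : ℝ) : ℂ) ≠ 0 := by exact_mod_cast hpos.ne'
  field_simp

/-- The Riesz potential bound: `|g| ≤ C |x|^{γ-n} * |(-Δ)^{γ/2} g|`, with a constant depending
only on `n` and `γ`. -/
theorem exists_enorm_le_riesz {γ : ℝ} (hγ : 0 < γ) (hγn : γ < n) :
    ∃ C : ℝ≥0, ∀ g : EuclideanSpace ℝ (Fin n) → ℂ, ContDiff ℝ ∞ g → HasCompactSupport g →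
      Continuous (fracLaplacian γ g) ∧
      ∀ x, ‖g x‖ₑ ≤ C * ∫⁻ y, ENNReal.ofReal (‖x - y‖ ^ (γ - n)) * ‖fracLaplacian γ g y‖ₑ := by
  have hn : 0 < n := by
    have : (0 : ℝ) < n := hγ.trans hγn
    exact_mod_cast this
  have : Nonempty (Fin n) := ⟨⟨0, hn⟩⟩
  set a : ℝ := (n - γ) / 2 with ha
  have hapos : 0 < a := by rw [ha]; linarith
  set c : ℝ := 4 ^ (γ / 2) * Real.Gamma (γ / 2) with hc
  have hcpos : 0 < c := mul_pos (by positivity) (Real.Gamma_pos_of_pos (by positivity))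
  have hΓ := Real.Gamma_pos_of_pos hapos
  set d : ℝ := Real.pi ^ (-((n : ℝ) / 2)) * Real.Gamma a with hd
  have hdpos : 0 < d := by positivity
  -- Here `c` normalizes the superposition of Gaussians, and `d |x - y|^{γ-n}` is the integral over
  -- `s` of the weighted Gaussians.
  refine ⟨(c⁻¹ * d).toNNReal, fun g hg hgc => ?_⟩
  set φ := hgc.toSchwartzMap hg with hφ
  have hgi : Integrable g := φ.integrable
  have hfour : ∀ w, (𝓕 φ : SchwartzMap _ ℂ) w = 𝓕 g w := fun w => rfl
  have hfi : Integrable (𝓕 g) := (𝓕 φ : SchwartzMap _ ℂ).integrable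
  have hpi : (2 * Real.pi)⁻¹ ≠ 0 := by positivity
  have hG : Integrable (fourierHat g) := by
    have := (integrable_comp_smul_iff (volume : Measure (EuclideanSpace ℝ (Fin n))) (𝓕 g) hpi).2 hfi
    exact this.congr (.of_forall fun ξ => (fourierHat_eq_fourier g ξ).symm)
  have hF : Integrable fun ξ => ((‖ξ‖ ^ γ : ℝ) : ℂ) * fourierHat g ξ := by
    have hψ : Integrable fun w => ((‖w‖ ^ γ : ℝ) : ℂ) * 𝓕 g w := by
      refine Integrable.mono' (hfi.norm.add ((𝓕 φ : SchwartzMap _ ℂ).integrable_pow_mul volume n))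
        (AEStronglyMeasurable.mul (Measurable.aestronglyMeasurable (by fun_prop))
          hfi.aestronglyMeasurable) (.of_forall fun w => ?_)
      simp only [Pi.add_apply, hfour]
      rw [norm_mul, Complex.norm_real, Real.norm_of_nonneg (by positivity), ← one_add_mul]
      refine mul_le_mul_of_nonneg_right ?_ (norm_nonneg _)
      rcases le_total ‖w‖ 1 with h | h
      · exact (Real.rpow_le_one (norm_nonneg _) h hγ.le).trans
          (le_add_of_nonneg_right (by positivity))
      · rw [← Real.rpow_natCast]
        exact (Real.rpow_le_rpow_of_exponent_le h hγn.le).trans (le_add_of_nonneg_left zero_le_one)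
    have := ((integrable_comp_smul_iff (volume : Measure (EuclideanSpace ℝ (Fin n))) _ hpi).2
      hψ).const_mul (((2 * Real.pi) ^ γ : ℝ) : ℂ)
    refine this.congr (.of_forall fun ξ => ?_)
    simp only
    rw [fourierHat_eq_fourier, ← mul_assoc, ← Complex.ofReal_mul,
      ← Real.mul_rpow (by positivity) (by positivity), norm_smul,
      Real.norm_of_nonneg (by positivity), mul_inv_cancel_left₀ (by positivity)]
  have hfcont : Continuous (fracLaplacian γ g) := continuous_fourierHatInv hF
  refine ⟨hfcont, fun x => ?_⟩
  have hsub := subordination_formula hγ hn hG hF x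
  rw [fourierHatInv_fourierHat hg.continuous hgi hfi x] at hsub
  change _ = ∫ s in Ioi (0 : ℝ), _ * ∫ y, _ * fracLaplacian γ g y at hsub
  set w : ℝ → ℝ := fun s => s ^ (-(γ / 2) - 1) * ((Real.pi / s) ^ ((n : ℝ) / 2))⁻¹ with hw
  have hbound : ENNReal.ofReal c * ‖g x‖ₑ ≤ ∫⁻ s in Ioi (0 : ℝ), ∫⁻ y,
      ENNReal.ofReal (w s * Real.exp (-(‖x - y‖ ^ 2 * s))) * ‖fracLaplacian γ g y‖ₑ := by
    have h1 : ENNReal.ofReal c * ‖g x‖ₑ = ‖(c : ℂ) * g x‖ₑ := by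
      rw [enorm_mul, ← ofReal_norm (c : ℂ), Complex.norm_real, Real.norm_of_nonneg hcpos.le]
    rw [h1, hsub]
    refine (enorm_integral_le_lintegral_enorm _).trans ?_
    refine setLIntegral_mono' measurableSet_Ioi fun s (hs : 0 < s) => ?_
    have hws : 0 ≤ w s := by simp only [hw]; positivity
    rw [enorm_mul]
    refine (mul_le_mul_right (enorm_integral_le_lintegral_enorm _) _).trans ?_
    rw [← lintegral_const_mul' _ _ enorm_ne_top]
    refine lintegral_mono fun y => ?_
    rw [enorm_mul, ← mul_assoc]
    refine mul_le_mul_left (le_of_eq ?_) _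
    rw [← enorm_mul, ← Complex.ofReal_mul, ← ofReal_norm, Complex.norm_real,
      Real.norm_of_nonneg (by positivity)]
    congr 3
    ring_nf
  have hswap : ∫⁻ s in Ioi (0 : ℝ), ∫⁻ y,
      ENNReal.ofReal (w s * Real.exp (-(‖x - y‖ ^ 2 * s))) * ‖fracLaplacian γ g y‖ₑ =
      ∫⁻ y, ∫⁻ s in Ioi (0 : ℝ),
      ENNReal.ofReal (w s * Real.exp (-(‖x - y‖ ^ 2 * s))) * ‖fracLaplacian γ g y‖ₑ := by
    refine lintegral_lintegral_swap (Measurable.aemeasurable ?_)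
    have := hfcont.measurable
    simp only [hw]
    fun_prop
  have hinner : ∀ᵐ y : EuclideanSpace ℝ (Fin n), ∫⁻ s in Ioi (0 : ℝ),
      ENNReal.ofReal (w s * Real.exp (-(‖x - y‖ ^ 2 * s))) * ‖fracLaplacian γ g y‖ₑ =
      ENNReal.ofReal d * (ENNReal.ofReal (‖x - y‖ ^ (γ - n)) * ‖fracLaplacian γ g y‖ₑ) := by
    have hne : ∀ᵐ y : EuclideanSpace ℝ (Fin n), y ≠ x := by
      simp [ae_iff, measure_singleton]
    filter_upwards [hne] with y hy
    have hρ : 0 < ‖x - y‖ := norm_pos_iff.2 (sub_ne_zero.2 hy.symm)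
    rw [lintegral_mul_const' _ _ enorm_ne_top, ← mul_assoc]
    congr 1
    have h1 : ∀ s ∈ Ioi (0 : ℝ), ENNReal.ofReal (w s * Real.exp (-(‖x - y‖ ^ 2 * s))) =
        ENNReal.ofReal (Real.pi ^ (-((n : ℝ) / 2))) *
          ENNReal.ofReal (s ^ (a - 1) * Real.exp (-(‖x - y‖ ^ 2 * s))) := by
      intro s (hs : 0 < s)
      rw [← ENNReal.ofReal_mul (by positivity), ← mul_assoc]
      congr 2
      simp only [hw]
      rw [Real.div_rpow Real.pi_pos.le hs.le, inv_div, Real.rpow_neg Real.pi_pos.le,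
        div_eq_mul_inv (s ^ ((n : ℝ) / 2)), ← mul_assoc, ← Real.rpow_add hs, mul_comm]
      congr 2
      rw [ha]; ring
    rw [setLIntegral_congr_fun measurableSet_Ioi h1, lintegral_const_mul' _ _ ENNReal.ofReal_ne_top,
      lintegral_rpow_mul_exp_neg_mul hapos (by positivity), ← ENNReal.ofReal_mul (by positivity),
      ← ENNReal.ofReal_mul hdpos.le]
    congr 1
    rw [one_div, Real.inv_rpow (by positivity), ← Real.rpow_natCast ‖x - y‖ 2,
      ← Real.rpow_mul hρ.le, ← Real.rpow_neg hρ.le, hd]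
    have : -(((2 : ℕ) : ℝ) * a) = γ - n := by rw [ha]; push_cast; ring
    rw [this]
    ring
  rw [hswap, lintegral_congr_ae hinner, lintegral_const_mul' _ _ ENNReal.ofReal_ne_top] at hbound
  have hc0 : ENNReal.ofReal c ≠ 0 := by simpa using hcpos
  calc ‖g x‖ₑ = (ENNReal.ofReal c)⁻¹ * (ENNReal.ofReal c * ‖g x‖ₑ) := by
        rw [← mul_assoc, ENNReal.inv_mul_cancel hc0 ENNReal.ofReal_ne_top, one_mul]
    _ ≤ (ENNReal.ofReal c)⁻¹ * _ := mul_le_mul_right hbound _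
    _ = _ := by
        rw [← mul_assoc, ← ENNReal.ofReal_inv_of_pos hcpos, ← ENNReal.ofReal_mul (by positivity)]
        rfl

end Potential

/-! ### Weighted integrals, scaling and antilipschitz changes of variables -/

section Tools

/-- Jensen's inequality for a weight `w` of arbitrary mass. -/
theorem rpow_lintegral_mul_le {α : Type*} [MeasurableSpace α] {μ : Measure α} {p : ℝ} (hp : 1 < p)
    {w H : α → ℝ≥0∞} (hw : AEMeasurable w μ) (hH : AEMeasurable H μ) :
    (∫⁻ x, w x * H x ∂μ) ^ p ≤ (∫⁻ x, w x ∂μ) ^ (p - 1) * ∫⁻ x, w x * H x ^ p ∂μ := by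
  have hp0 : 0 < p := by linarith
  have hpq := Real.HolderConjugate.conjExponent hp
  set p' := p.conjExponent
  have hp'0 : 0 < p' := hpq.symm.pos
  have h := ENNReal.lintegral_mul_le_Lp_mul_Lq μ hpq.symm (hw.pow_const (1 / p'))
    ((hw.pow_const (1 / p)).mul hH)
  have h1 : ∀ x, ((fun x => w x ^ (1 / p')) * ((fun x => w x ^ (1 / p)) * H)) x = w x * H x := by
    intro x
    simp only [Pi.mul_apply]
    rw [← mul_assoc, ← ENNReal.rpow_add_of_nonneg _ _ (by positivity) (by positivity)]
    rw [one_div, one_div, hpq.symm.inv_add_inv_eq_one, ENNReal.rpow_one]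
  have h2 : ∀ x, (w x ^ (1 / p')) ^ p' = w x := by
    intro x
    rw [← ENNReal.rpow_mul, one_div_mul_cancel hp'0.ne', ENNReal.rpow_one]
  have h3 : ∀ x, (((fun x => w x ^ (1 / p)) * H) x) ^ p = w x * H x ^ p := by
    intro x
    simp only [Pi.mul_apply]
    rw [ENNReal.mul_rpow_of_nonneg _ _ hp0.le, ← ENNReal.rpow_mul, one_div_mul_cancel hp0.ne',
      ENNReal.rpow_one]
  simp only [h1, h2, h3] at h
  calc _ ≤ _ := ENNReal.rpow_le_rpow h hp0.le
    _ = _ := by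
      rw [ENNReal.mul_rpow_of_nonneg _ _ hp0.le, ← ENNReal.rpow_mul, ← ENNReal.rpow_mul,
        one_div_mul_cancel hp0.ne', ENNReal.rpow_one]
      congr 2
      rw [one_div, inv_mul_eq_div]
      exact hpq.div_conj_eq_sub_one

variable {n : ℕ}

theorem lintegral_comp_smul_pos {f : EuclideanSpace ℝ (Fin n) → ℝ≥0∞} (hf : Measurable f) {R : ℝ}
    (hR : 0 < R) : ∫⁻ x, f x = ENNReal.ofReal (R ^ n) * ∫⁻ z, f (R • z) := by
  have h := lintegral_map (μ := volume) hf
    (measurable_const_smul R : Measurable fun x : EuclideanSpace ℝ (Fin n) => R • x)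
  rw [Measure.map_addHaar_smul _ hR.ne', lintegral_smul_measure, finrank_euclideanSpace_fin,
    abs_of_pos (by positivity)] at h
  rw [← h, smul_eq_mul, ← mul_assoc, ← ENNReal.ofReal_mul (by positivity),
    mul_inv_cancel₀ (by positivity), ENNReal.ofReal_one, one_mul]

theorem exists_setLIntegral_ball_rpow_neg [NeZero n] {b : ℝ} (hb : b < n) :
    ∃ c : ℝ≥0, ∀ r : ℝ, 0 < r →
      ∫⁻ x in Metric.ball (0 : EuclideanSpace ℝ (Fin n)) r, ENNReal.ofReal (‖x‖ ^ (-b)) =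
        c * ENNReal.ofReal (r ^ (n - b)) := by
  have hfin : ∫⁻ x in Metric.ball (0 : EuclideanSpace ℝ (Fin n)) 1,
      ENNReal.ofReal (‖x‖ ^ (-b)) ≠ ⊤ := by
    have := integrableOn_ball_of_norm_le_rpow (μ := (volume : Measure (EuclideanSpace ℝ (Fin n))))
      (f := fun x => ‖x‖ ^ (-b)) (C := 1) (α := b) (r := 1)
      (by simpa using NeZero.one_le) (by simpa using hb)
      (.of_forall fun x => by rw [one_mul, Real.norm_of_nonneg (by positivity)])
      (Measurable.aestronglyMeasurable (by fun_prop))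
    exact this.lintegral_lt_top.ne
  refine ⟨(∫⁻ x in Metric.ball (0 : EuclideanSpace ℝ (Fin n)) 1,
      ENNReal.ofReal (‖x‖ ^ (-b))).toNNReal, fun r hr => ?_⟩
  rw [ENNReal.coe_toNNReal hfin, ← lintegral_indicator Metric.isOpen_ball.measurableSet,
    lintegral_comp_smul_pos (Measurable.indicator (by fun_prop) Metric.isOpen_ball.measurableSet)
      hr, ← lintegral_indicator Metric.isOpen_ball.measurableSet, mul_comm,
    ← lintegral_mul_const' _ _ ENNReal.ofReal_ne_top,
    ← lintegral_mul_const' _ _ ENNReal.ofReal_ne_top]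
  refine lintegral_congr fun z => ?_
  have hmem : r • z ∈ Metric.ball (0 : EuclideanSpace ℝ (Fin n)) r ↔
      z ∈ Metric.ball (0 : EuclideanSpace ℝ (Fin n)) 1 := by
    simp only [mem_ball_zero_iff, norm_smul, Real.norm_of_nonneg hr.le]
    exact mul_lt_iff_lt_one_right hr
  by_cases hz : z ∈ Metric.ball (0 : EuclideanSpace ℝ (Fin n)) 1
  · rw [indicator_of_mem (hmem.2 hz), indicator_of_mem hz, norm_smul, Real.norm_of_nonneg hr.le,
      Real.mul_rpow hr.le (norm_nonneg _), ← ENNReal.ofReal_mul (by positivity),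
      ← ENNReal.ofReal_mul (by positivity), sub_eq_add_neg, Real.rpow_add hr, Real.rpow_natCast]
    congr 1
    ring
  · rw [indicator_of_notMem (fun h => hz (hmem.1 h)), indicator_of_notMem hz, zero_mul, zero_mul]

/-- By homogeneity, integrating the kernel `max(ρ, |z|)^{γ-n}` against `|z|^{-a}` gives a multiple
of `ρ^{γ-a}`; it converges at the origin when `a < n` and at infinity when `γ < a`. -/
theorem exists_lintegral_max_rpow_mul [NeZero n] {γ a : ℝ} (ha : γ < a)
    (han : a < n) :
    ∃ J : ℝ≥0, ∀ ρ : ℝ, 0 < ρ →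
      ∫⁻ z : EuclideanSpace ℝ (Fin n), ENNReal.ofReal (max ρ ‖z‖ ^ (γ - n)) *
        ENNReal.ofReal (‖z‖ ^ (-a)) = J * ENNReal.ofReal (ρ ^ (γ - a)) := by
  have hfin : ∫⁻ z : EuclideanSpace ℝ (Fin n), ENNReal.ofReal (max 1 ‖z‖ ^ (γ - n)) *
        ENNReal.ofReal (‖z‖ ^ (-a)) ≠ ⊤ := by
    obtain ⟨c, hc⟩ := exists_setLIntegral_ball_rpow_neg (n := n) han
    have h1 : ∫⁻ z in Metric.ball (0 : EuclideanSpace ℝ (Fin n)) 1,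
        ENNReal.ofReal (max 1 ‖z‖ ^ (γ - n)) * ENNReal.ofReal (‖z‖ ^ (-a)) < ⊤ := by
      refine lt_of_le_of_lt (b := (c : ℝ≥0∞) * ENNReal.ofReal (1 ^ (n - a))) ?_
        (ENNReal.mul_lt_top ENNReal.coe_lt_top ENNReal.ofReal_lt_top)
      rw [← hc 1 one_pos]
      refine lintegral_mono fun z => ?_
      refine mul_le_of_le_one_left' ?_
      rw [ENNReal.ofReal_le_one]
      exact Real.rpow_le_one_of_one_le_of_nonpos (le_max_left _ _) (by linarith)
    have h2 : ∫⁻ z in (Metric.ball (0 : EuclideanSpace ℝ (Fin n)) 1)ᶜ,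
        ENNReal.ofReal (max 1 ‖z‖ ^ (γ - n)) * ENNReal.ofReal (‖z‖ ^ (-a)) < ⊤ := by
      have hi := integrable_one_add_norm (E := EuclideanSpace ℝ (Fin n)) (μ := volume)
        (r := n - γ + a) (by simp; linarith)
      refine lt_of_le_of_lt ?_ (hi.const_mul (2 ^ (n - γ + a))).lintegral_lt_top
      refine (setLIntegral_mono' Metric.isOpen_ball.measurableSet.compl fun z hz => ?_).trans
        (setLIntegral_le_lintegral _ _)
      have hz1 : 1 ≤ ‖z‖ := by simpa using hz
      have hz0 : 0 < ‖z‖ := by linarith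
      rw [max_eq_right hz1, ← ENNReal.ofReal_mul (by positivity), ← Real.rpow_add hz0]
      refine ENNReal.ofReal_le_ofReal ?_
      have : γ - n + -a = -(n - γ + a) := by ring
      rw [this]
      calc ‖z‖ ^ (-(n - γ + a)) ≤ ((1 + ‖z‖) / 2) ^ (-(n - γ + a)) :=
            Real.rpow_le_rpow_of_nonpos (by positivity) (by linarith) (by linarith)
        _ = 2 ^ (n - γ + a) * (1 + ‖z‖) ^ (-(n - γ + a)) := by
            rw [Real.div_rpow (by positivity) (by norm_num), Real.rpow_neg (zero_le_two (α := ℝ)),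
              div_inv_eq_mul, mul_comm]
    rw [← lintegral_add_compl _ (Metric.isOpen_ball (x := (0 : EuclideanSpace ℝ (Fin n)))
      (ε := 1)).measurableSet]
    exact (ENNReal.add_lt_top.2 ⟨h1, h2⟩).ne
  refine ⟨(∫⁻ z : EuclideanSpace ℝ (Fin n), ENNReal.ofReal (max 1 ‖z‖ ^ (γ - n)) *
        ENNReal.ofReal (‖z‖ ^ (-a))).toNNReal, fun ρ hρ => ?_⟩
  rw [ENNReal.coe_toNNReal hfin, lintegral_comp_smul_pos (by fun_prop) hρ, mul_comm,
    ← lintegral_mul_const' _ _ ENNReal.ofReal_ne_top,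
    ← lintegral_mul_const' _ _ ENNReal.ofReal_ne_top]
  refine lintegral_congr fun z => ?_
  have hm : max ρ (ρ * ‖z‖) = ρ * max 1 ‖z‖ := by
    rw [mul_max_of_nonneg _ _ hρ.le, mul_one]
  rw [norm_smul, Real.norm_of_nonneg hρ.le, hm, Real.mul_rpow hρ.le (by positivity),
    Real.mul_rpow hρ.le (by positivity), ← ENNReal.ofReal_mul (by positivity),
    ← ENNReal.ofReal_mul (by positivity), ← ENNReal.ofReal_mul (by positivity),
    ← ENNReal.ofReal_mul (by positivity)]
  congr 1
  have : ρ ^ (γ - a) = ρ ^ (γ - n) * ρ ^ (-a) * ρ ^ n := by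
    rw [← Real.rpow_natCast ρ n, ← Real.rpow_add hρ, ← Real.rpow_add hρ]
    congr 1
    ring
  rw [this]
  ring

/-- Lebesgue measure is a multiple of the Hausdorff measure, which antilipschitz maps control. -/
theorem volume_preimage_le_of_antilipschitz
    {Φ : EuclideanSpace ℝ (Fin n) → EuclideanSpace ℝ (Fin n)}
    {K : ℝ≥0} (hΦ : AntilipschitzWith K Φ) (s : Set (EuclideanSpace ℝ (Fin n))) :
    volume (Φ ⁻¹' s) ≤ (K : ℝ≥0∞) ^ n * volume s := by
  have hH : (Measure.hausdorffMeasure (n : ℝ) :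
      Measure (EuclideanSpace ℝ (Fin n))).IsAddHaarMeasure := by
    simpa using isAddHaarMeasure_hausdorffMeasure (E := EuclideanSpace ℝ (Fin n))
  have h := Measure.isAddLeftInvariant_eq_smul (volume : Measure (EuclideanSpace ℝ (Fin n)))
    (Measure.hausdorffMeasure (n : ℝ))
  rw [h, Measure.smul_apply, Measure.smul_apply, ENNReal.smul_def, ENNReal.smul_def, smul_eq_mul,
    smul_eq_mul, mul_left_comm]
  refine mul_le_mul_right ?_ _
  simpa using hΦ.hausdorffMeasure_preimage_le (Nat.cast_nonneg n) s

theorem lintegral_comp_le_of_antilipschitz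
    {Φ : EuclideanSpace ℝ (Fin n) → EuclideanSpace ℝ (Fin n)} {K : ℝ≥0} (hΦ : AntilipschitzWith K Φ)
    (hm : Measurable Φ) {f : EuclideanSpace ℝ (Fin n) → ℝ≥0∞} (hf : Measurable f) :
    ∫⁻ x, f (Φ x) ≤ (K : ℝ≥0∞) ^ n * ∫⁻ x, f x := by
  rw [← lintegral_map hf hm, ← smul_eq_mul, ← lintegral_smul_measure]
  refine lintegral_mono' (Measure.le_iff.2 fun s hs => ?_) le_rfl
  rw [Measure.map_apply hm hs]
  exact volume_preimage_le_of_antilipschitz hΦ s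

end Tools

/-! ### The potential near the diagonal -/

section NearPart

variable {n : ℕ}

theorem antilipschitzWith_add_norm_smul {z : EuclideanSpace ℝ (Fin n)} (hz : ‖z‖ ≤ 1 / 2) :
    AntilipschitzWith 2 fun x : EuclideanSpace ℝ (Fin n) => x + ‖x‖ • z := by
  refine AntilipschitzWith.of_le_mul_dist fun x y => ?_
  rw [dist_eq_norm, dist_eq_norm]
  have h1 : x - y = (x + ‖x‖ • z - (y + ‖y‖ • z)) - (‖x‖ - ‖y‖) • z := by
    rw [sub_smul]; abel
  have h2 : ‖(‖x‖ - ‖y‖) • z‖ ≤ ‖x - y‖ * (1 / 2) := by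
    rw [norm_smul]
    exact mul_le_mul (abs_norm_sub_norm_le x y) hz (norm_nonneg _) (norm_nonneg _)
  have h3 := norm_sub_le (x + ‖x‖ • z - (y + ‖y‖ • z)) ((‖x‖ - ‖y‖) • z)
  rw [← h1] at h3
  push_cast
  linarith

theorem dist_add_norm_smul_le {z : EuclideanSpace ℝ (Fin n)} (hz : ‖z‖ ≤ 1 / 2)
    (x y : EuclideanSpace ℝ (Fin n)) :
    dist (x + ‖x‖ • z) (y + ‖y‖ • z) ≤ 3 / 2 * dist x y := by
  rw [dist_eq_norm, dist_eq_norm]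
  have h1 : x + ‖x‖ • z - (y + ‖y‖ • z) = (x - y) + (‖x‖ - ‖y‖) • z := by
    rw [sub_smul]; abel
  have h2 : ‖(‖x‖ - ‖y‖) • z‖ ≤ ‖x - y‖ * (1 / 2) := by
    rw [norm_smul]
    exact mul_le_mul (abs_norm_sub_norm_le x y) hz (norm_nonneg _) (norm_nonneg _)
  rw [h1]
  have h3 := norm_add_le (x - y) ((‖x‖ - ‖y‖) • z)
  linarith

/-- The part of the weighted Riesz potential close to the diagonal, rescaled to the unit size. -/
theorem riesz_near_eq [NeZero n] {γ : ℝ} {h : EuclideanSpace ℝ (Fin n) → ℝ≥0∞} (hh : Measurable h)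
    {x : EuclideanSpace ℝ (Fin n)} (hx : x ≠ 0) :
    ENNReal.ofReal (‖x‖ ^ (-γ)) * ∫⁻ y in {y | ‖x - y‖ < ‖x‖ / 2},
      ENNReal.ofReal (‖x - y‖ ^ (γ - n)) * h y =
    ∫⁻ z in Metric.ball (0 : EuclideanSpace ℝ (Fin n)) (1 / 2),
      ENNReal.ofReal (‖z‖ ^ (γ - n)) * h (x + ‖x‖ • z) := by
  have hρ : 0 < ‖x‖ := norm_pos_iff.2 hx
  have hS : MeasurableSet {y : EuclideanSpace ℝ (Fin n) | ‖x - y‖ < ‖x‖ / 2} :=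
    measurableSet_lt (by fun_prop) (by fun_prop)
  rw [← lintegral_indicator hS, ← lintegral_indicator Metric.isOpen_ball.measurableSet,
    ← lintegral_add_left_eq_self _ x,
    lintegral_comp_smul_pos (R := ‖x‖) _ hρ, ← mul_assoc, ← ENNReal.ofReal_mul (by positivity),
    ← lintegral_const_mul' _ _ ENNReal.ofReal_ne_top]
  · refine lintegral_congr fun z => ?_
    have hn : ‖x - (x + ‖x‖ • z)‖ = ‖x‖ * ‖z‖ := by
      rw [sub_add_cancel_left, norm_neg, norm_smul, norm_norm]
    have hmem : x + ‖x‖ • z ∈ {y : EuclideanSpace ℝ (Fin n) | ‖x - y‖ < ‖x‖ / 2} ↔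
        z ∈ Metric.ball (0 : EuclideanSpace ℝ (Fin n)) (1 / 2) := by
      rw [mem_ofPred_eq, hn, mem_ball_zero_iff, div_eq_mul_one_div]
      exact mul_lt_mul_iff_right₀ hρ
    by_cases hz : z ∈ Metric.ball (0 : EuclideanSpace ℝ (Fin n)) (1 / 2)
    · rw [indicator_of_mem (hmem.2 hz), indicator_of_mem hz, hn, ← mul_assoc,
        ← ENNReal.ofReal_mul (by positivity)]
      congr 2
      rw [Real.mul_rpow hρ.le (norm_nonneg _), ← mul_assoc, ← Real.rpow_natCast ‖x‖ n,
        ← Real.rpow_add hρ, ← Real.rpow_add hρ]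
      have : -γ + n + (γ - n) = 0 := by ring
      rw [this, Real.rpow_zero, one_mul]
    · rw [indicator_of_notMem (fun h => hz (hmem.1 h)), indicator_of_notMem hz, mul_zero]
  · refine Measurable.comp (Measurable.indicator ?_ hS) (measurable_const_add x)
    fun_prop

/-- The near part of the weighted potential inherits the growth bound of `h`: by Jensen's inequality
it suffices to bound each `x ↦ h (x + ‖x‖ • z)`, and `x ↦ x + ‖x‖ • z` maps `B(a, r)` into a ball of
radius `3 r / 2` while shrinking volumes by at most `2 ^ n`. -/
theorem exists_near_bound [NeZero n] {p γ κ : ℝ} (hp : 1 < p) (hγ : 0 < γ) :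
    ∃ C : ℝ≥0, ∀ h : EuclideanSpace ℝ (Fin n) → ℝ≥0∞, Measurable h → ∀ N : ℝ≥0∞,
      (∀ a, ∀ r : ℝ, 0 < r → ∫⁻ x in Metric.ball a r, h x ^ p ≤ N * ENNReal.ofReal (r ^ κ)) →
      ∀ a, ∀ r : ℝ, 0 < r → ∫⁻ x in Metric.ball a r,
        (∫⁻ z in Metric.ball (0 : EuclideanSpace ℝ (Fin n)) (1 / 2),
          ENNReal.ofReal (‖z‖ ^ (γ - n)) * h (x + ‖x‖ • z)) ^ p ≤
        C * N * ENNReal.ofReal (r ^ κ) := by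
  obtain ⟨c, hc⟩ := exists_setLIntegral_ball_rpow_neg (n := n) (b := n - γ) (by linarith)
  simp only [neg_sub] at hc
  obtain ⟨W, hWeq⟩ : ∃ W : ℝ≥0, ∫⁻ z in Metric.ball (0 : EuclideanSpace ℝ (Fin n)) (1 / 2),
      ENNReal.ofReal (‖z‖ ^ (γ - n)) = W :=
    ⟨c * ((1 / 2 : ℝ) ^ (n - (n - γ))).toNNReal, by
      rw [hc _ (by norm_num), ENNReal.coe_mul]; rfl⟩
  refine ⟨W ^ (p - 1) * (W * (2 ^ n * ((3 / 2 : ℝ) ^ κ).toNNReal)), fun h hh N hN a r hr => ?_⟩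
  have hp1 : 0 ≤ p - 1 := by linarith
  have hstep : ∀ x, (∫⁻ z in Metric.ball (0 : EuclideanSpace ℝ (Fin n)) (1 / 2),
          ENNReal.ofReal (‖z‖ ^ (γ - n)) * h (x + ‖x‖ • z)) ^ p ≤
      (W : ℝ≥0∞) ^ (p - 1) * ∫⁻ z in Metric.ball (0 : EuclideanSpace ℝ (Fin n)) (1 / 2),
          ENNReal.ofReal (‖z‖ ^ (γ - n)) * h (x + ‖x‖ • z) ^ p := by
    intro x
    rw [← hWeq]
    refine rpow_lintegral_mul_le hp (Measurable.aemeasurable (by fun_prop))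
      (Measurable.aemeasurable (by fun_prop))
  have hmeas : Measurable (Function.uncurry fun x z : EuclideanSpace ℝ (Fin n) =>
      ENNReal.ofReal (‖z‖ ^ (γ - n)) * h (x + ‖x‖ • z) ^ p) := by
    simp only [Function.uncurry_def]
    fun_prop
  calc _ ≤ ∫⁻ x in Metric.ball a r, (W : ℝ≥0∞) ^ (p - 1) *
          ∫⁻ z in Metric.ball (0 : EuclideanSpace ℝ (Fin n)) (1 / 2),
          ENNReal.ofReal (‖z‖ ^ (γ - n)) * h (x + ‖x‖ • z) ^ p := lintegral_mono hstep
    _ = (W : ℝ≥0∞) ^ (p - 1) * ∫⁻ z in Metric.ball (0 : EuclideanSpace ℝ (Fin n)) (1 / 2),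
          ∫⁻ x in Metric.ball a r, ENNReal.ofReal (‖z‖ ^ (γ - n)) * h (x + ‖x‖ • z) ^ p := by
        rw [lintegral_const_mul' _ _ (ENNReal.rpow_ne_top_of_nonneg hp1 ENNReal.coe_ne_top),
          lintegral_lintegral_swap hmeas.aemeasurable]
    _ ≤ (W : ℝ≥0∞) ^ (p - 1) * ∫⁻ z in Metric.ball (0 : EuclideanSpace ℝ (Fin n)) (1 / 2),
          ENNReal.ofReal (‖z‖ ^ (γ - n)) *
            (2 ^ n * ENNReal.ofReal ((3 / 2 : ℝ) ^ κ) * N * ENNReal.ofReal (r ^ κ)) := by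
        refine mul_le_mul_right (setLIntegral_mono' Metric.isOpen_ball.measurableSet
          fun z hz => ?_) _
        have hz' : ‖z‖ ≤ 1 / 2 := (mem_ball_zero_iff.1 hz).le
        rw [lintegral_const_mul' _ _ ENNReal.ofReal_ne_top]
        refine mul_le_mul_right ?_ _
        set B := Metric.ball (a + ‖a‖ • z) (3 / 2 * r) with hB
        have hBm : MeasurableSet B := Metric.isOpen_ball.measurableSet
        calc ∫⁻ x in Metric.ball a r, h (x + ‖x‖ • z) ^ p
            = ∫⁻ x in Metric.ball a r, B.indicator (fun y => h y ^ p) (x + ‖x‖ • z) := by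
              refine setLIntegral_congr_fun Metric.isOpen_ball.measurableSet fun x hx => ?_
              rw [indicator_of_mem]
              exact (dist_add_norm_smul_le hz' x a).trans_lt
                (mul_lt_mul_of_pos_left hx (by norm_num))
          _ ≤ ∫⁻ x, B.indicator (fun y => h y ^ p) (x + ‖x‖ • z) := setLIntegral_le_lintegral _ _
          _ ≤ ((2 : ℝ≥0) : ℝ≥0∞) ^ n * ∫⁻ x, B.indicator (fun y => h y ^ p) x :=
              lintegral_comp_le_of_antilipschitz (antilipschitzWith_add_norm_smul hz')
                (by fun_prop) ((hh.pow_const p).indicator hBm)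
          _ ≤ 2 ^ n * (N * ENNReal.ofReal ((3 / 2 * r) ^ κ)) := by
              rw [lintegral_indicator hBm]
              exact mul_le_mul_right (hN _ _ (by positivity)) _
          _ = _ := by
              rw [Real.mul_rpow (by norm_num) hr.le, ENNReal.ofReal_mul (by positivity)]
              ring
    _ = _ := by
        rw [lintegral_mul_const _ (by fun_prop), hWeq, ENNReal.coe_mul, ENNReal.coe_mul,
          ENNReal.coe_mul, ENNReal.coe_rpow_of_nonneg _ hp1]
        simp only [ENNReal.ofReal]
        push_cast
        ring

end NearPart

/-! ### The potential away from the diagonal -/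

section FarPart

variable {n : ℕ}

/-- The tail of the kernel `|y|^{γ-n}` against a function of growth `r^σ`, summed over the dyadic
shells `2 ^ k * r ≤ |y| < 2 ^ (k + 1) * r`. -/
theorem exists_tail_bound {γ σ : ℝ} (hγn : γ < n) (hσ : σ + γ - n < 0) :
    ∃ C : ℝ≥0, ∀ (h : EuclideanSpace ℝ (Fin n) → ℝ≥0∞) (M : ℝ≥0∞),
      (∀ r : ℝ, 0 < r → ∫⁻ y in Metric.ball 0 r, h y ≤ M * ENNReal.ofReal (r ^ σ)) →
      ∀ r : ℝ, 0 < r → ∫⁻ y in (Metric.ball 0 r)ᶜ, ENNReal.ofReal (‖y‖ ^ (γ - n)) * h y ≤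
        C * M * ENNReal.ofReal (r ^ (σ + γ - n)) := by
  set θ : ℝ≥0∞ := ENNReal.ofReal (2 ^ (σ + γ - n)) with hθ
  have hθ1 : θ < 1 := by
    rw [hθ, ENNReal.ofReal_lt_one]
    exact Real.rpow_lt_one_of_one_lt_of_neg one_lt_two hσ
  have hgeo : (1 - θ)⁻¹ ≠ ⊤ := by
    rw [ENNReal.inv_ne_top]
    exact (tsub_pos_of_lt hθ1).ne'
  refine ⟨((2 : ℝ) ^ σ).toNNReal * ((1 - θ)⁻¹).toNNReal, fun h M hM r hr => ?_⟩
  set A : ℕ → Set (EuclideanSpace ℝ (Fin n)) := fun k =>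
    (Metric.ball 0 (2 ^ k * r))ᶜ ∩ Metric.ball 0 (2 ^ (k + 1) * r) with hA
  have hcover : (Metric.ball (0 : EuclideanSpace ℝ (Fin n)) r)ᶜ ⊆ ⋃ k, A k := by
    intro y hy
    have hy' : 1 ≤ ‖y‖ / r := by
      rw [le_div_iff₀ hr, one_mul]; simpa using hy
    obtain ⟨k, hk1, hk2⟩ := exists_nat_pow_near hy' one_lt_two
    rw [le_div_iff₀ hr] at hk1
    rw [div_lt_iff₀ hr] at hk2
    exact mem_iUnion.2 ⟨k, by simpa using hk1, by simpa using hk2⟩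
  have hterm : ∀ k, ∫⁻ y in A k, ENNReal.ofReal (‖y‖ ^ (γ - n)) * h y ≤
      ENNReal.ofReal (2 ^ σ) * M * ENNReal.ofReal (r ^ (σ + γ - n)) * θ ^ k := by
    intro k
    have hk : (0 : ℝ) < 2 ^ k * r := by positivity
    calc ∫⁻ y in A k, ENNReal.ofReal (‖y‖ ^ (γ - n)) * h y
        ≤ ∫⁻ y in A k, ENNReal.ofReal ((2 ^ k * r) ^ (γ - n)) * h y := by
          refine setLIntegral_mono' (Metric.isOpen_ball.measurableSet.compl.inter
            Metric.isOpen_ball.measurableSet) fun y hy => ?_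
          refine mul_le_mul_left (ENNReal.ofReal_le_ofReal ?_) _
          have : 2 ^ k * r ≤ ‖y‖ := by simpa using hy.1
          exact Real.rpow_le_rpow_of_nonpos hk this (by linarith)
      _ ≤ ∫⁻ y in Metric.ball 0 (2 ^ (k + 1) * r),
            ENNReal.ofReal ((2 ^ k * r) ^ (γ - n)) * h y := lintegral_mono_set inter_subset_right
      _ ≤ ENNReal.ofReal ((2 ^ k * r) ^ (γ - n)) *
            (M * ENNReal.ofReal ((2 ^ (k + 1) * r) ^ σ)) := by
          rw [lintegral_const_mul' _ _ ENNReal.ofReal_ne_top]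
          exact mul_le_mul_right (hM _ (by positivity)) _
      _ = _ := by
          have e1 : ((2 : ℝ) ^ (k + 1) * r) ^ σ = 2 ^ σ * (2 ^ k * r) ^ σ := by
            rw [← Real.mul_rpow (by norm_num) hk.le]
            congr 1
            ring
          have e2 : ((2 : ℝ) ^ k * r) ^ (γ - n) * (2 ^ k * r) ^ σ =
              r ^ (σ + γ - n) * (2 ^ (σ + γ - n)) ^ k := by
            rw [← Real.rpow_add hk, Real.mul_rpow (by positivity) hr.le, ← Real.rpow_natCast,
              ← Real.rpow_natCast, ← Real.rpow_mul (by norm_num), ← Real.rpow_mul (by norm_num),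
              mul_comm (k : ℝ), mul_comm]
            congr 2 <;> ring
          have e3 : ENNReal.ofReal ((2 ^ k * r) ^ (γ - n)) * ENNReal.ofReal ((2 ^ k * r) ^ σ) =
              ENNReal.ofReal (r ^ (σ + γ - n)) * θ ^ k := by
            rw [hθ, ← ENNReal.ofReal_pow (by positivity), ← ENNReal.ofReal_mul (by positivity),
              ← ENNReal.ofReal_mul (by positivity), e2]
          rw [e1, ENNReal.ofReal_mul (by positivity), mul_assoc _ _ (θ ^ k), ← e3]
          ring
  calc _ ≤ ∫⁻ y in ⋃ k, A k, ENNReal.ofReal (‖y‖ ^ (γ - n)) * h y := lintegral_mono_set hcover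
    _ ≤ ∑' k, ∫⁻ y in A k, ENNReal.ofReal (‖y‖ ^ (γ - n)) * h y := lintegral_iUnion_le _ _
    _ ≤ ∑' k, ENNReal.ofReal (2 ^ σ) * M * ENNReal.ofReal (r ^ (σ + γ - n)) * θ ^ k :=
        ENNReal.tsum_le_tsum hterm
    _ = _ := by
        rw [ENNReal.tsum_mul_left, ENNReal.tsum_geometric, ENNReal.coe_mul,
          ENNReal.coe_toNNReal hgeo]
        simp only [ENNReal.ofReal]
        ring

/-- The Hardy-type majorant `|x|^{-γ} ∫ max(|x|, |y|)^{γ-n} h(y) dy` of the weighted Riesz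
potential away from the diagonal. It is radial and decreasing in `|x|`. -/
noncomputable def farPotential (γ : ℝ) (h : EuclideanSpace ℝ (Fin n) → ℝ≥0∞)
    (x : EuclideanSpace ℝ (Fin n)) : ℝ≥0∞ :=
  ENNReal.ofReal (‖x‖ ^ (-γ)) * ∫⁻ y, ENNReal.ofReal (max ‖x‖ ‖y‖ ^ (γ - n)) * h y

theorem measurable_farPotential {γ : ℝ} {h : EuclideanSpace ℝ (Fin n) → ℝ≥0∞} (hh : Measurable h) :
    Measurable (farPotential γ h) := by
  unfold farPotential
  refine Measurable.mul (by fun_prop) (Measurable.lintegral_prod_right' (f := fun z :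
    EuclideanSpace ℝ (Fin n) × EuclideanSpace ℝ (Fin n) =>
      ENNReal.ofReal (max ‖z.1‖ ‖z.2‖ ^ (γ - n)) * h z.2) ?_)
  fun_prop

theorem farPotential_anti {γ : ℝ} (hγ : 0 < γ) (hγn : γ < n)
    (h : EuclideanSpace ℝ (Fin n) → ℝ≥0∞) {x x' : EuclideanSpace ℝ (Fin n)} (hx : x ≠ 0)
    (hxx' : ‖x‖ ≤ ‖x'‖) : farPotential γ h x' ≤ farPotential γ h x := by
  have hρ := norm_pos_iff.2 hx
  refine mul_le_mul' (ENNReal.ofReal_le_ofReal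
    (Real.rpow_le_rpow_of_nonpos hρ hxx' (by linarith))) (lintegral_mono fun y => ?_)
  refine mul_le_mul_left (ENNReal.ofReal_le_ofReal ?_) _
  exact Real.rpow_le_rpow_of_nonpos (lt_max_of_lt_left hρ) (max_le_max_right _ hxx') (by linarith)

theorem ae_ne_zero [NeZero n] : ∀ᵐ x : EuclideanSpace ℝ (Fin n), x ≠ 0 := by
  have : Nonempty (Fin n) := ⟨0⟩
  simp [ae_iff, measure_singleton]

/-- Schur's test with the weight `|y|^a`: the Hardy-type majorant is bounded on `L^p` when
`γ < n / p`. -/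
theorem exists_lintegral_farPotential_rpow_le [NeZero n] {p γ : ℝ} (hp : 1 < p) (hγ : 0 < γ)
    (hγp : γ * p < n) :
    ∃ C : ℝ≥0, ∀ h : EuclideanSpace ℝ (Fin n) → ℝ≥0∞, Measurable h →
      ∫⁻ x, farPotential γ h x ^ p ≤ C * ∫⁻ x, h x ^ p := by
  have hp1 : 0 < p - 1 := by linarith
  have hp0 : 0 < p := by linarith
  have hγn : γ < n := by nlinarith
  -- The first integral in Schur's test converges for `γ < a < n`, the dual one for
  -- `γ < γ + a (p - 1) < n`.
  obtain ⟨a, hγa, ha⟩ : ∃ a, γ < a ∧ a < min (n : ℝ) ((n - γ) / (p - 1)) := by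
    refine exists_between (lt_min hγn ?_)
    rw [lt_div_iff₀ hp1]; linarith
  have han : a < n := ha.trans_le (min_le_left _ _)
  have ha2 : a * (p - 1) < n - γ := by
    rw [← lt_div_iff₀ hp1]; exact ha.trans_le (min_le_right _ _)
  have ha0 : 0 < a := hγ.trans hγa
  set b : ℝ := γ + a * (p - 1) with hb
  obtain ⟨J, hJ⟩ := exists_lintegral_max_rpow_mul (n := n) hγa han
  obtain ⟨J', hJ'⟩ := exists_lintegral_max_rpow_mul (n := n) (γ := γ) (a := b)
    (by rw [hb]; nlinarith) (by rw [hb]; linarith)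
  refine ⟨J ^ (p - 1) * J', fun h hh => ?_⟩
  have hpt : ∀ᵐ x : EuclideanSpace ℝ (Fin n), farPotential γ h x ^ p ≤
      (J : ℝ≥0∞) ^ (p - 1) * ∫⁻ y, ENNReal.ofReal (max ‖y‖ ‖x‖ ^ (γ - n)) *
        ENNReal.ofReal (‖x‖ ^ (-b)) * (ENNReal.ofReal (‖y‖ ^ (a * (p - 1))) * h y ^ p) := by
    filter_upwards [ae_ne_zero] with x hx
    have hρ := norm_pos_iff.2 hx
    have h1 : ∫⁻ y, ENNReal.ofReal (max ‖x‖ ‖y‖ ^ (γ - n)) * h y =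
        ∫⁻ y, (ENNReal.ofReal (max ‖x‖ ‖y‖ ^ (γ - n)) * ENNReal.ofReal (‖y‖ ^ (-a))) *
          (ENNReal.ofReal (‖y‖ ^ a) * h y) := by
      refine lintegral_congr_ae ?_
      filter_upwards [ae_ne_zero] with y hy
      have hy' := norm_pos_iff.2 hy
      have : ENNReal.ofReal (‖y‖ ^ (-a)) * ENNReal.ofReal (‖y‖ ^ a) = 1 := by
        rw [← ENNReal.ofReal_mul (by positivity), ← Real.rpow_add hy']; simp
      rw [mul_assoc, ← mul_assoc (ENNReal.ofReal (‖y‖ ^ (-a))), this, one_mul]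
    have h2 := rpow_lintegral_mul_le (μ := (volume : Measure (EuclideanSpace ℝ (Fin n)))) hp
      (w := fun y => ENNReal.ofReal (max ‖x‖ ‖y‖ ^ (γ - n)) * ENNReal.ofReal (‖y‖ ^ (-a)))
      (H := fun y => ENNReal.ofReal (‖y‖ ^ a) * h y) (Measurable.aemeasurable (by fun_prop))
      (Measurable.aemeasurable (by fun_prop))
    rw [farPotential, ENNReal.mul_rpow_of_nonneg _ _ hp0.le, h1]
    refine (mul_le_mul_right h2 _).trans (le_of_eq ?_)
    have hpow : ENNReal.ofReal ((‖x‖ ^ (-γ)) ^ p) * ENNReal.ofReal ((‖x‖ ^ (γ - a)) ^ (p - 1)) =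
        ENNReal.ofReal (‖x‖ ^ (-b)) := by
      rw [← ENNReal.ofReal_mul (by positivity), ← Real.rpow_mul hρ.le, ← Real.rpow_mul hρ.le,
        ← Real.rpow_add hρ]
      congr 2
      rw [hb]; ring
    rw [hJ _ hρ, ENNReal.mul_rpow_of_nonneg _ _ hp1.le, ENNReal.ofReal_rpow_of_nonneg
      (by positivity) hp0.le, ENNReal.ofReal_rpow_of_nonneg (by positivity) hp1.le,
      mul_assoc ((J : ℝ≥0∞) ^ (p - 1)), mul_left_comm, ← mul_assoc (ENNReal.ofReal _), hpow,
      ← lintegral_const_mul' _ _ ENNReal.ofReal_ne_top]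
    congr 1
    refine lintegral_congr_ae ?_
    filter_upwards [ae_ne_zero] with y hy
    have hy' := norm_pos_iff.2 hy
    have hpow' : ENNReal.ofReal (‖y‖ ^ (-a)) * ENNReal.ofReal ((‖y‖ ^ a) ^ p) =
        ENNReal.ofReal (‖y‖ ^ (a * (p - 1))) := by
      rw [← ENNReal.ofReal_mul (by positivity), ← Real.rpow_mul hy'.le, ← Real.rpow_add hy']
      congr 2
      ring
    rw [ENNReal.mul_rpow_of_nonneg _ _ hp0.le, ENNReal.ofReal_rpow_of_nonneg (by positivity) hp0.le,
      ← hpow', max_comm]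
    ring
  have hmeas : Measurable (Function.uncurry fun x y : EuclideanSpace ℝ (Fin n) =>
      ENNReal.ofReal (max ‖y‖ ‖x‖ ^ (γ - n)) * ENNReal.ofReal (‖x‖ ^ (-b)) *
        (ENNReal.ofReal (‖y‖ ^ (a * (p - 1))) * h y ^ p)) := by
    simp only [Function.uncurry_def]
    fun_prop
  refine (lintegral_mono_ae hpt).trans ?_
  rw [lintegral_const_mul' _ _ (ENNReal.rpow_ne_top_of_nonneg hp1.le ENNReal.coe_ne_top),
    lintegral_lintegral_swap hmeas.aemeasurable, ENNReal.coe_mul,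
    ENNReal.coe_rpow_of_nonneg _ hp1.le, mul_assoc]
  refine mul_le_mul_right (le_of_eq ?_) _
  rw [← lintegral_const_mul' _ _ ENNReal.coe_ne_top]
  refine lintegral_congr_ae ?_
  filter_upwards [ae_ne_zero] with y hy
  have hy' := norm_pos_iff.2 hy
  rw [lintegral_mul_const _ (by fun_prop), hJ' _ hy', ← mul_assoc, mul_assoc (J' : ℝ≥0∞),
    ← ENNReal.ofReal_mul (by positivity), ← Real.rpow_add hy']
  have : γ - b + a * (p - 1) = 0 := by rw [hb]; ring
  rw [this, Real.rpow_zero, ENNReal.ofReal_one, mul_one]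

/-- A radially decreasing function has its largest integral over a ball at the origin, up to a
factor `2`. -/
theorem lintegral_ball_le_of_anti [NeZero n] {F : EuclideanSpace ℝ (Fin n) → ℝ≥0∞}
    (hF : ∀ x x', x ≠ 0 → ‖x‖ ≤ ‖x'‖ → F x' ≤ F x) (a : EuclideanSpace ℝ (Fin n)) (r : ℝ) :
    ∫⁻ x in Metric.ball a r, F x ≤ 2 * ∫⁻ x in Metric.ball 0 r, F x := by
  have hm : MeasurableSet (Metric.ball (0 : EuclideanSpace ℝ (Fin n)) r) :=
    Metric.isOpen_ball.measurableSet
  -- Outside `B(0, r)` the function is at most `T`, and inside it is at least `T`; the part of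
  -- `B(a, r)` outside `B(0, r)` is then compared with `B(0, r)`, which has the same volume as
  -- `B(a, r)`.
  set T : ℝ≥0∞ := ⨆ x ∈ (Metric.ball (0 : EuclideanSpace ℝ (Fin n)) r)ᶜ, F x with hT
  have hout : ∫⁻ x in Metric.ball a r ∩ (Metric.ball 0 r)ᶜ, F x ≤ ∫⁻ x in Metric.ball 0 r, F x :=
    calc ∫⁻ x in Metric.ball a r ∩ (Metric.ball 0 r)ᶜ, F x
        ≤ ∫⁻ x in Metric.ball a r ∩ (Metric.ball 0 r)ᶜ, T :=
          setLIntegral_mono' (Metric.isOpen_ball.measurableSet.inter hm.compl)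
            fun x hx => le_iSup₂_of_le x hx.2 le_rfl
      _ ≤ ∫⁻ x in Metric.ball a r, T := lintegral_mono_set inter_subset_left
      _ = ∫⁻ x in Metric.ball (0 : EuclideanSpace ℝ (Fin n)) r, T := by
          rw [setLIntegral_const, setLIntegral_const, Measure.addHaar_ball_center]
      _ ≤ ∫⁻ x in Metric.ball 0 r, F x := by
          refine lintegral_mono_ae ?_
          filter_upwards [ae_restrict_mem hm, ae_restrict_of_ae ae_ne_zero] with x hx hx0
          refine iSup₂_le fun x' hx' => hF x x' hx0 ?_
          have h1 : ‖x‖ < r := by simpa using hx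
          have h2 : r ≤ ‖x'‖ := by simpa using hx'
          exact h1.le.trans h2
  have hin : ∫⁻ x in Metric.ball a r ∩ Metric.ball 0 r, F x ≤ ∫⁻ x in Metric.ball 0 r, F x :=
    lintegral_mono_set inter_subset_right
  rw [← lintegral_inter_add_sdiff F (Metric.ball a r) hm, two_mul]
  exact add_le_add hin hout

/-- On a ball at the origin, the Morrey bound on `p`-th powers gives one on the mean. -/
theorem setLIntegral_ball_rpow_le {p κ : ℝ} (hp : 1 < p)
    {h : EuclideanSpace ℝ (Fin n) → ℝ≥0∞} (hh : Measurable h) {N : ℝ≥0∞}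
    (hN : ∀ a, ∀ r : ℝ, 0 < r → ∫⁻ x in Metric.ball a r, h x ^ p ≤ N * ENNReal.ofReal (r ^ κ))
    {r : ℝ} (hr : 0 < r) :
    ∫⁻ x in Metric.ball (0 : EuclideanSpace ℝ (Fin n)) r, h x ≤
      (volume (Metric.ball (0 : EuclideanSpace ℝ (Fin n)) 1) ^ (p - 1) * N) ^ (1 / p) *
        ENNReal.ofReal (r ^ (n + (κ - n) / p)) := by
  have hp0 : 0 < p := by linarith
  have hp1 : 0 < p - 1 := by linarith
  have h1 := rpow_lintegral_mul_le
    (μ := (volume : Measure (EuclideanSpace ℝ (Fin n))).restrict (Metric.ball 0 r)) hp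
    (w := fun _ => 1) aemeasurable_const hh.aemeasurable
  simp only [one_mul, lintegral_const, Measure.restrict_apply_univ] at h1
  rw [Measure.addHaar_ball_of_pos _ _ hr, finrank_euclideanSpace_fin] at h1
  have h2 := h1.trans (mul_le_mul_right (hN 0 r hr) _)
  have h3 : (ENNReal.ofReal (r ^ n) * volume (Metric.ball (0 : EuclideanSpace ℝ (Fin n)) 1)) ^
      (p - 1) * (N * ENNReal.ofReal (r ^ κ)) =
      volume (Metric.ball (0 : EuclideanSpace ℝ (Fin n)) 1) ^ (p - 1) * N *
        ENNReal.ofReal (r ^ (n + (κ - n) / p)) ^ p := by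
    have h4 : ENNReal.ofReal (r ^ (n + (κ - n) / p)) ^ p =
        ENNReal.ofReal (r ^ n) ^ (p - 1) * ENNReal.ofReal (r ^ κ) := by
      rw [ENNReal.ofReal_rpow_of_nonneg (by positivity) hp0.le,
        ENNReal.ofReal_rpow_of_nonneg (by positivity) hp1.le, ← ENNReal.ofReal_mul (by positivity),
        ← Real.rpow_natCast, ← Real.rpow_mul hr.le, ← Real.rpow_mul hr.le, ← Real.rpow_add hr]
      congr 2
      field_simp
      ring
    rw [h4, ENNReal.mul_rpow_of_nonneg _ _ hp1.le]
    ring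
  rw [h3] at h2
  have h5 := ENNReal.rpow_le_rpow h2 (one_div_pos.2 hp0).le
  rwa [ENNReal.mul_rpow_of_nonneg _ _ (one_div_pos.2 hp0).le, ← ENNReal.rpow_mul,
    ← ENNReal.rpow_mul, mul_one_div_cancel hp0.ne', ENNReal.rpow_one, ENNReal.rpow_one] at h5

/-- The far part inherits the growth bound of `h`. On `B(0, r)` the function `h` is split at
`|y| = r`: the inner part is bounded in `L^p`, the outer part contributes at most
`|x|^{-γ} r^{σ+γ-n}` with `σ = n + (κ - n) / p`, whose `p`-th power is integrable at the origin. -/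
theorem exists_far_bound [NeZero n] {p γ κ : ℝ} (hp : 1 < p) (hγ : 0 < γ) (hκ : 0 ≤ κ)
    (hγp : γ * p < n - κ) :
    ∃ C : ℝ≥0, ∀ h : EuclideanSpace ℝ (Fin n) → ℝ≥0∞, Measurable h → ∀ N : ℝ≥0∞,
      (∀ a, ∀ r : ℝ, 0 < r → ∫⁻ x in Metric.ball a r, h x ^ p ≤ N * ENNReal.ofReal (r ^ κ)) →
      ∀ a, ∀ r : ℝ, 0 < r → ∫⁻ x in Metric.ball a r, farPotential γ h x ^ p ≤
        C * N * ENNReal.ofReal (r ^ κ) := by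
  have hp0 : 0 < p := by linarith
  have hp1 : 0 < p - 1 := by linarith
  have hγn : γ < n := by nlinarith
  set σ : ℝ := n + (κ - n) / p with hσ
  have hσ' : σ + γ - n < 0 := by
    have : γ < (n - κ) / p := by rwa [lt_div_iff₀ hp0]
    have e : (n - κ) / p = -((κ - n) / p) := by ring
    rw [hσ]; linarith
  obtain ⟨C₁, hC₁⟩ := exists_lintegral_farPotential_rpow_le (n := n) hp hγ (by linarith)
  obtain ⟨C₂, hC₂⟩ := exists_tail_bound (n := n) (γ := γ) (σ := σ) hγn hσ'
  obtain ⟨c, hc⟩ := exists_setLIntegral_ball_rpow_neg (n := n) (b := γ * p) (by linarith)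
  obtain ⟨V, hV⟩ : ∃ V : ℝ≥0, volume (Metric.ball (0 : EuclideanSpace ℝ (Fin n)) 1) = V :=
    ⟨_, (ENNReal.coe_toNNReal measure_ball_lt_top.ne).symm⟩
  refine ⟨2 * (2 ^ (p - 1) * (C₁ + c * (C₂ ^ p * V ^ (p - 1)))), fun h hh N hN a r hr => ?_⟩
  refine (lintegral_ball_le_of_anti (fun x x' hx hxx' => ENNReal.rpow_le_rpow
    (farPotential_anti hγ hγn h hx hxx') hp0.le) a r).trans ?_
  set B := Metric.ball (0 : EuclideanSpace ℝ (Fin n)) r with hB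
  have hBm : MeasurableSet B := Metric.isOpen_ball.measurableSet
  have hmean := fun (r : ℝ) (hr : 0 < r) => setLIntegral_ball_rpow_le hp hh hN hr
  rw [hV] at hmean
  set T : ℝ≥0∞ := ∫⁻ y in Bᶜ, ENNReal.ofReal (‖y‖ ^ (γ - n)) * h y with hT
  have hTp : T ^ p ≤ C₂ ^ p * (V ^ (p - 1) * N) * ENNReal.ofReal (r ^ (κ - n + γ * p)) := by
    refine (ENNReal.rpow_le_rpow (hC₂ h _ hmean r hr) hp0.le).trans (le_of_eq ?_)
    rw [ENNReal.mul_rpow_of_nonneg _ _ hp0.le, ENNReal.mul_rpow_of_nonneg _ _ hp0.le,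
      ← ENNReal.rpow_mul, one_div_mul_cancel hp0.ne', ENNReal.rpow_one,
      ENNReal.ofReal_rpow_of_nonneg (by positivity) hp0.le, ← Real.rpow_mul hr.le]
    congr 3
    rw [hσ]
    field_simp
    ring
  have hsplit : ∀ x ∈ B, farPotential γ h x ^ p ≤ 2 ^ (p - 1) *
      (farPotential γ (B.indicator h) x ^ p + ENNReal.ofReal (‖x‖ ^ (-(γ * p))) * T ^ p) := by
    intro x hx
    have hxr : ‖x‖ < r := by simpa [hB] using hx
    have h1 : farPotential γ h x =
        farPotential γ (B.indicator h) x + ENNReal.ofReal (‖x‖ ^ (-γ)) * T := by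
      rw [farPotential, farPotential, ← mul_add, ← lintegral_add_compl _ hBm,
        ← lintegral_indicator hBm]
      congr 2
      · refine lintegral_congr fun y => ?_
        by_cases hy : y ∈ B <;> simp [hy]
      · refine setLIntegral_congr_fun hBm.compl fun y hy => ?_
        have : r ≤ ‖y‖ := by simpa [hB] using hy
        rw [max_eq_right (hxr.le.trans this)]
    have h2 : ENNReal.ofReal (‖x‖ ^ (-(γ * p))) * T ^ p =
        (ENNReal.ofReal (‖x‖ ^ (-γ)) * T) ^ p := by
      rw [ENNReal.mul_rpow_of_nonneg _ _ hp0.le, ENNReal.ofReal_rpow_of_nonneg (by positivity)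
        hp0.le, ← Real.rpow_mul (norm_nonneg _), neg_mul]
    rw [h1, h2]
    exact ENNReal.rpow_add_le_mul_rpow_add_rpow _ _ hp.le
  have hind : ∫⁻ x, B.indicator h x ^ p = ∫⁻ x in B, h x ^ p := by
    rw [← lintegral_indicator hBm]
    refine lintegral_congr fun x => ?_
    by_cases hx : x ∈ B <;> simp [hx, hp0]
  have h2top : (2 : ℝ≥0∞) ^ (p - 1) ≠ ⊤ := ENNReal.rpow_ne_top_of_nonneg hp1.le (by simp)
  have hmain : ∫⁻ x in B, farPotential γ h x ^ p ≤ 2 ^ (p - 1) * (C₁ * (N * ENNReal.ofReal (r ^ κ))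
      + c * ENNReal.ofReal (r ^ (n - γ * p)) *
        (C₂ ^ p * (V ^ (p - 1) * N) * ENNReal.ofReal (r ^ (κ - n + γ * p)))) := by
    refine (setLIntegral_mono' hBm hsplit).trans ?_
    rw [lintegral_const_mul' _ _ h2top, lintegral_add_right _ (by fun_prop),
      lintegral_mul_const _ (by fun_prop), hc r hr]
    refine mul_le_mul_right (add_le_add ?_ (mul_le_mul_right hTp _)) _
    refine (setLIntegral_le_lintegral _ _).trans ((hC₁ _ (hh.indicator hBm)).trans ?_)
    rw [hind]
    exact mul_le_mul_right (hN 0 r hr) _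
  refine (mul_le_mul_right hmain _).trans (le_of_eq ?_)
  have hr' : ENNReal.ofReal (r ^ (n - γ * p)) * ENNReal.ofReal (r ^ (κ - n + γ * p)) =
      ENNReal.ofReal (r ^ κ) := by
    rw [← ENNReal.ofReal_mul (by positivity), ← Real.rpow_add hr]
    congr 2
    ring
  push_cast
  rw [← hr', ENNReal.coe_rpow_of_nonneg _ hp1.le, ENNReal.coe_rpow_of_nonneg _ hp1.le,
    ENNReal.coe_rpow_of_nonneg _ hp0.le]
  push_cast
  ring

end FarPart

/-! ### Hardy's inequality for the Riesz potential -/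

section Hardy

variable {n : ℕ}

theorem riesz_le_near_add_far [NeZero n] {γ : ℝ} (hγn : γ < n)
    {h : EuclideanSpace ℝ (Fin n) → ℝ≥0∞} (hh : Measurable h)
    {x : EuclideanSpace ℝ (Fin n)} (hx : x ≠ 0) :
    ENNReal.ofReal (‖x‖ ^ (-γ)) * ∫⁻ y, ENNReal.ofReal (‖x - y‖ ^ (γ - n)) * h y ≤
      (∫⁻ z in Metric.ball (0 : EuclideanSpace ℝ (Fin n)) (1 / 2),
        ENNReal.ofReal (‖z‖ ^ (γ - n)) * h (x + ‖x‖ • z)) +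
      ENNReal.ofReal (3 ^ (n - γ)) * farPotential γ h x := by
  have hρ := norm_pos_iff.2 hx
  have hS : MeasurableSet {y : EuclideanSpace ℝ (Fin n) | ‖x - y‖ < ‖x‖ / 2} :=
    measurableSet_lt (by fun_prop) (by fun_prop)
  rw [← lintegral_add_compl _ hS, mul_add, riesz_near_eq hh hx]
  refine add_le_add le_rfl ?_
  rw [farPotential, mul_left_comm]
  refine mul_le_mul_right ?_ _
  rw [← lintegral_const_mul' _ _ ENNReal.ofReal_ne_top]
  refine (setLIntegral_mono' hS.compl fun y hy => ?_).trans (setLIntegral_le_lintegral _ _)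
  rw [← mul_assoc, ← ENNReal.ofReal_mul (by positivity)]
  refine mul_le_mul_left (ENNReal.ofReal_le_ofReal ?_) _
  have h1 : ‖x‖ / 2 ≤ ‖x - y‖ := by simpa using hy
  have h2 : ‖y‖ ≤ ‖x‖ + ‖x - y‖ := by
    have := norm_sub_le x (x - y)
    simpa using this
  have hm : 0 < max ‖x‖ ‖y‖ := lt_max_of_lt_left hρ
  -- `|x| ≤ 2 |x - y|` gives `|y| ≤ |x| + |x - y| ≤ 3 |x - y|`.
  have h3 : max ‖x‖ ‖y‖ / 3 ≤ ‖x - y‖ := by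
    rw [div_le_iff₀ (by norm_num)]
    exact max_le (by linarith) (by linarith)
  calc ‖x - y‖ ^ (γ - n) ≤ (max ‖x‖ ‖y‖ / 3) ^ (γ - n) :=
        Real.rpow_le_rpow_of_nonpos (by positivity) h3 (by linarith)
    _ = 3 ^ (n - γ) * max ‖x‖ ‖y‖ ^ (γ - n) := by
        rw [Real.div_rpow hm.le (by norm_num), div_eq_mul_inv, ← Real.rpow_neg (by norm_num),
          neg_sub, mul_comm]

/-- Hardy's inequality for the Riesz potential, in terms of the growth of `p`-th powers on balls. -/
theorem exists_hardy_riesz_bound [NeZero n] {p γ κ : ℝ} (hp : 1 < p) (hγ : 0 < γ) (hκ : 0 ≤ κ)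
    (hγp : γ * p < n - κ) :
    ∃ C : ℝ≥0, ∀ h : EuclideanSpace ℝ (Fin n) → ℝ≥0∞, Measurable h → ∀ N : ℝ≥0∞,
      (∀ a, ∀ r : ℝ, 0 < r → ∫⁻ x in Metric.ball a r, h x ^ p ≤ N * ENNReal.ofReal (r ^ κ)) →
      ∀ a, ∀ r : ℝ, 0 < r → ∫⁻ x in Metric.ball a r, (ENNReal.ofReal (‖x‖ ^ (-γ)) *
        ∫⁻ y, ENNReal.ofReal (‖x - y‖ ^ (γ - n)) * h y) ^ p ≤
        C * N * ENNReal.ofReal (r ^ κ) := by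
  have hp0 : 0 < p := by linarith
  have hp1 : 0 < p - 1 := by linarith
  have hγn : γ < n := by nlinarith
  obtain ⟨C₁, hC₁⟩ := exists_near_bound (n := n) (κ := κ) hp hγ
  obtain ⟨C₂, hC₂⟩ := exists_far_bound (n := n) hp hγ hκ hγp
  set K : ℝ≥0 := ((3 : ℝ) ^ (n - γ)).toNNReal with hK
  refine ⟨2 ^ (p - 1) * (C₁ + K ^ p * C₂), fun h hh N hN a r hr => ?_⟩
  have h2top : (2 : ℝ≥0∞) ^ (p - 1) ≠ ⊤ := ENNReal.rpow_ne_top_of_nonneg hp1.le (by simp)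
  have hpt : ∀ᵐ x ∂volume.restrict (Metric.ball a r), (ENNReal.ofReal (‖x‖ ^ (-γ)) *
        ∫⁻ y, ENNReal.ofReal (‖x - y‖ ^ (γ - n)) * h y) ^ p ≤
      2 ^ (p - 1) * ((∫⁻ z in Metric.ball (0 : EuclideanSpace ℝ (Fin n)) (1 / 2),
        ENNReal.ofReal (‖z‖ ^ (γ - n)) * h (x + ‖x‖ • z)) ^ p +
        (K : ℝ≥0∞) ^ p * farPotential γ h x ^ p) := by
    filter_upwards [ae_restrict_of_ae ae_ne_zero] with x hx
    rw [← ENNReal.mul_rpow_of_nonneg _ _ hp0.le]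
    exact (ENNReal.rpow_le_rpow (riesz_le_near_add_far hγn hh hx) hp0.le).trans
      (ENNReal.rpow_add_le_mul_rpow_add_rpow _ _ hp.le)
  refine (lintegral_mono_ae hpt).trans ?_
  have hfar := (measurable_farPotential (γ := γ) hh).pow_const p
  rw [lintegral_const_mul' _ _ h2top, lintegral_add_right _ (hfar.const_mul _),
    lintegral_const_mul _ hfar]
  refine (mul_le_mul_right (add_le_add (hC₁ h hh N hN a r hr)
    (mul_le_mul_right (hC₂ h hh N hN a r hr) _)) _).trans (le_of_eq ?_)
  push_cast
  rw [ENNReal.coe_rpow_of_nonneg _ hp1.le, ENNReal.coe_rpow_of_nonneg _ hp0.le]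
  push_cast
  ring

end Hardy

/-! ### Morrey norms -/

section Morrey

variable {n : ℕ}

theorem setLIntegral_ball_le_morreyNorm {p q : ℝ} (hp : 0 < p)
    (f : EuclideanSpace ℝ (Fin n) → ℂ) (a : EuclideanSpace ℝ (Fin n)) {r : ℝ} (hr : 0 < r) :
    ∫⁻ x in Metric.ball a r, ‖f x‖ₑ ^ p ≤
      volume (Metric.ball a r) ^ (1 - p / q) * morreyNorm p q f ^ p := by
  have hv0 : volume (Metric.ball a r) ≠ 0 := (Metric.measure_ball_pos volume a hr).ne'
  have hvt : volume (Metric.ball a r) ≠ ⊤ := measure_ball_lt_top.ne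
  have h : volume (Metric.ball a r) ^ (1 / q - 1 / p) *
      (∫⁻ y in Metric.ball a r, ‖f y‖ₑ ^ p) ^ (1 / p) ≤ morreyNorm p q f :=
    le_iSup_of_le a (le_iSup₂_of_le r hr le_rfl)
  have h' := ENNReal.rpow_le_rpow h hp.le
  rw [ENNReal.mul_rpow_of_nonneg _ _ hp.le, ← ENNReal.rpow_mul, ← ENNReal.rpow_mul,
    one_div_mul_cancel hp.ne', ENNReal.rpow_one] at h'
  refine le_trans (le_of_eq ?_) (mul_le_mul_right h' _)
  rw [← mul_assoc, ← ENNReal.rpow_add _ _ hv0 hvt]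
  have : 1 - p / q + (1 / q - 1 / p) * p = 0 := by
    field_simp
    ring
  rw [this, ENNReal.rpow_zero, one_mul]

theorem morreyNorm_le_of_forall_ball {p q : ℝ} (hp : 0 < p)
    {f : EuclideanSpace ℝ (Fin n) → ℂ} {M : ℝ≥0∞}
    (h : ∀ a, ∀ r : ℝ, 0 < r → ∫⁻ x in Metric.ball a r, ‖f x‖ₑ ^ p ≤
      volume (Metric.ball a r) ^ (1 - p / q) * M ^ p) : morreyNorm p q f ≤ M := by
  refine iSup_le fun a => iSup₂_le fun r hr => ?_
  have hv0 : volume (Metric.ball a r) ≠ 0 := (Metric.measure_ball_pos volume a hr).ne'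
  have hvt : volume (Metric.ball a r) ≠ ⊤ := measure_ball_lt_top.ne
  have hp' : 0 ≤ 1 / p := (one_div_pos.2 hp).le
  refine (mul_le_mul_right (ENNReal.rpow_le_rpow (h a r hr) hp') _).trans (le_of_eq ?_)
  rw [ENNReal.mul_rpow_of_nonneg _ _ hp', ← ENNReal.rpow_mul, ← ENNReal.rpow_mul,
    mul_one_div_cancel hp.ne', ENNReal.rpow_one, ← mul_assoc, ← ENNReal.rpow_add _ _ hv0 hvt]
  have : 1 / q - 1 / p + (1 - p / q) * (1 / p) = 0 := by
    field_simp
    ring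
  rw [this, ENNReal.rpow_zero, one_mul]

/-- Hölder's inequality in Morrey spaces. -/
theorem morreyNorm_le_mul_of_enorm_le {p q p₂ q₂ p₀ q₀ θ η : ℝ} (hp : 0 < p) (hp₂ : 0 < p₂)
    (hp₀ : 0 < p₀) (hθ : 0 ≤ θ) (hη : 0 ≤ η)
    (hp' : 1 / p₀ = θ / p₂ + η / p) (hq' : 1 / q₀ = θ / q₂ + η / q)
    {f u v : EuclideanSpace ℝ (Fin n) → ℂ} (hu : Measurable u) (hv : Measurable v)
    (hf : ∀ᵐ x, ‖f x‖ₑ ≤ ‖u x‖ₑ ^ θ * ‖v x‖ₑ ^ η) :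
    morreyNorm p₀ q₀ f ≤ morreyNorm p₂ q₂ u ^ θ * morreyNorm p q v ^ η := by
  refine iSup_le fun a => iSup₂_le fun r hr => ?_
  have hv0 : volume (Metric.ball a r) ≠ 0 := (Metric.measure_ball_pos volume a hr).ne'
  have hvt : volume (Metric.ball a r) ≠ ⊤ := measure_ball_lt_top.ne
  have hp₀' : 0 ≤ 1 / p₀ := (one_div_pos.2 hp₀).le
  have hα : 0 ≤ θ * p₀ / p₂ := by positivity
  have hβ : 0 ≤ η * p₀ / p := by positivity
  have hsum : θ * p₀ / p₂ + η * p₀ / p = 1 := by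
    have : θ * p₀ / p₂ + η * p₀ / p = p₀ * (θ / p₂ + η / p) := by ring
    rw [this, ← hp', mul_one_div_cancel hp₀.ne']
  set μ := (volume : Measure (EuclideanSpace ℝ (Fin n))).restrict (Metric.ball a r) with hμ
  set I := ∫⁻ y, ‖u y‖ₑ ^ p₂ ∂μ with hI
  set J := ∫⁻ y, ‖v y‖ₑ ^ p ∂μ with hJ
  have hH : ∫⁻ y, ‖f y‖ₑ ^ p₀ ∂μ ≤ I ^ (θ * p₀ / p₂) * J ^ (η * p₀ / p) := by
    refine le_trans (lintegral_mono_ae ?_) (ENNReal.lintegral_mul_norm_pow_le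
      (hu.enorm.pow_const p₂).aemeasurable (hv.enorm.pow_const p).aemeasurable hα hβ hsum)
    filter_upwards [ae_restrict_of_ae hf] with x hx
    refine (ENNReal.rpow_le_rpow hx hp₀.le).trans (le_of_eq ?_)
    rw [ENNReal.mul_rpow_of_nonneg _ _ hp₀.le, ← ENNReal.rpow_mul, ← ENNReal.rpow_mul,
      ← ENNReal.rpow_mul, ← ENNReal.rpow_mul, mul_div_cancel₀ _ hp₂.ne', mul_div_cancel₀ _ hp.ne']
  have hU : volume (Metric.ball a r) ^ (1 / q₂ - 1 / p₂) * I ^ (1 / p₂) ≤ morreyNorm p₂ q₂ u :=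
    le_iSup_of_le a (le_iSup₂_of_le r hr le_rfl)
  have hV : volume (Metric.ball a r) ^ (1 / q - 1 / p) * J ^ (1 / p) ≤ morreyNorm p q v :=
    le_iSup_of_le a (le_iSup₂_of_le r hr le_rfl)
  refine le_trans ?_ (mul_le_mul' (ENNReal.rpow_le_rpow hU hθ) (ENNReal.rpow_le_rpow hV hη))
  refine (mul_le_mul_right (ENNReal.rpow_le_rpow hH hp₀') _).trans (le_of_eq ?_)
  rw [ENNReal.mul_rpow_of_nonneg _ _ hp₀', ENNReal.mul_rpow_of_nonneg _ _ hθ,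
    ENNReal.mul_rpow_of_nonneg _ _ hη]
  simp only [← ENNReal.rpow_mul]
  have e1 : θ * p₀ / p₂ * (1 / p₀) = 1 / p₂ * θ := by field_simp
  have e2 : η * p₀ / p * (1 / p₀) = 1 / p * η := by field_simp
  have e3 : 1 / q₀ - 1 / p₀ = (1 / q₂ - 1 / p₂) * θ + (1 / q - 1 / p) * η := by
    rw [hp', hq']; ring
  rw [e1, e2, e3, ENNReal.rpow_add _ _ hv0 hvt]
  ring

/-- Hardy's inequality for the fractional Laplacian in Morrey spaces. -/
theorem exists_hardy_morreyNorm_le [NeZero n] {p q γ : ℝ} (hp : 1 < p) (hpq : p ≤ q) (hγ : 0 < γ)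
    (hγn : γ < n / q) :
    ∃ C : ℝ≥0, ∀ g : EuclideanSpace ℝ (Fin n) → ℂ, ContDiff ℝ ∞ g → HasCompactSupport g →
      morreyNorm p q (fun x => ((‖x‖ ^ (-γ) : ℝ) : ℂ) * g x) ≤
        C * morreyNorm p q (fracLaplacian γ g) := by
  have hp0 : 0 < p := by linarith
  have hq0 : 0 < q := by linarith
  have hγq : γ * q < n := by rwa [lt_div_iff₀ hq0] at hγn
  have hγn' : γ < n := by nlinarith
  set κ : ℝ := n * (1 - p / q) with hκ
  have hpq1 : p / q ≤ 1 := (div_le_one hq0).2 hpq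
  have hκ0 : 0 ≤ κ := mul_nonneg (Nat.cast_nonneg n) (by linarith)
  have hγp : γ * p < n - κ := by
    have : n - κ = n / q * p := by rw [hκ]; ring
    rw [this]
    exact mul_lt_mul_of_pos_right hγn hp0
  obtain ⟨A, hA⟩ := exists_enorm_le_riesz (n := n) hγ hγn'
  obtain ⟨C, hC⟩ := exists_hardy_riesz_bound (n := n) hp hγ hκ0 hγp
  refine ⟨A * C ^ (1 / p), fun g hg hgc => morreyNorm_le_of_forall_ball hp0 fun a r hr => ?_⟩
  obtain ⟨hcont, hriesz⟩ := hA g hg hgc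
  set M := morreyNorm p q (fracLaplacian γ g) with hM
  have hvol : ∀ (b : EuclideanSpace ℝ (Fin n)) (s : ℝ), 0 < s →
      volume (Metric.ball b s) ^ (1 - p / q) =
        volume (Metric.ball (0 : EuclideanSpace ℝ (Fin n)) 1) ^ (1 - p / q) *
          ENNReal.ofReal (s ^ κ) := by
    intro b s hs
    rw [Measure.addHaar_ball_of_pos _ _ hs, finrank_euclideanSpace_fin,
      ENNReal.mul_rpow_of_nonneg _ _ (by linarith), mul_comm,
      ENNReal.ofReal_rpow_of_nonneg (by positivity) (by linarith), ← Real.rpow_natCast,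
      ← Real.rpow_mul hs.le]
  have hbound := hC (fun y => ‖fracLaplacian γ g y‖ₑ) hcont.measurable.enorm
    (volume (Metric.ball (0 : EuclideanSpace ℝ (Fin n)) 1) ^ (1 - p / q) * M ^ p)
    (fun b s hs => by
      refine (setLIntegral_ball_le_morreyNorm (q := q) hp0 _ b hs).trans (le_of_eq ?_)
      rw [hvol b s hs]
      ring) a r hr
  have hAt : (A : ℝ≥0∞) ^ p ≠ ⊤ := ENNReal.rpow_ne_top_of_nonneg hp0.le ENNReal.coe_ne_top
  calc ∫⁻ x in Metric.ball a r, ‖((‖x‖ ^ (-γ) : ℝ) : ℂ) * g x‖ₑ ^ p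
      ≤ ∫⁻ x in Metric.ball a r, (A : ℝ≥0∞) ^ p * (ENNReal.ofReal (‖x‖ ^ (-γ)) *
        ∫⁻ y, ENNReal.ofReal (‖x - y‖ ^ (γ - n)) * ‖fracLaplacian γ g y‖ₑ) ^ p := by
        refine lintegral_mono fun x => ?_
        rw [← ENNReal.mul_rpow_of_nonneg _ _ hp0.le]
        refine ENNReal.rpow_le_rpow ?_ hp0.le
        rw [enorm_mul, ← ofReal_norm ((‖x‖ ^ (-γ) : ℝ) : ℂ), Complex.norm_real,
          Real.norm_of_nonneg (by positivity), mul_left_comm]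
        exact mul_le_mul_right (hriesz x) _
    _ ≤ (A : ℝ≥0∞) ^ p * (C * (volume (Metric.ball (0 : EuclideanSpace ℝ (Fin n)) 1) ^ (1 - p / q) *
          M ^ p) * ENNReal.ofReal (r ^ κ)) := by
        rw [lintegral_const_mul' _ _ hAt]
        exact mul_le_mul_right hbound _
    _ = _ := by
        rw [hvol a r hr, ENNReal.mul_rpow_of_nonneg _ _ hp0.le, ENNReal.coe_mul,
          ENNReal.mul_rpow_of_nonneg _ _ hp0.le, ENNReal.coe_rpow_of_nonneg _
          (one_div_pos.2 hp0).le, ← ENNReal.rpow_mul, one_div_mul_cancel hp0.ne', ENNReal.rpow_one]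
        ring

end Morrey

theorem theorem3p4 (n : ℕ) (p q p₂ q₂ β γ p₀ q₀ : ℝ)
    (hp : 1 < p) (hpq : p ≤ q) (hp₂ : 1 ≤ p₂) (hpq₂ : p₂ ≤ q₂)
    (hβ : 0 < β) (hγ : 0 < γ) (hγn : γ < n / q)
    (hp₀ : (β + γ) / p₀ = β / p + γ / p₂)
    (hq₀ : (β + γ) / q₀ = β / q + γ / q₂) :
    ∃ C : ℝ≥0, ∀ g : EuclideanSpace ℝ (Fin n) → ℂ, ContDiff ℝ ∞ g → HasCompactSupport g →
      morreyNorm p₀ q₀ g ≤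
        C * morreyNorm p₂ q₂ (fun x => ((‖x‖ ^ β : ℝ) : ℂ) * g x) ^ (γ / (β + γ)) *
          morreyNorm p q (fracLaplacian γ g) ^ (β / (β + γ)) := by
  have hn : NeZero n := by
    refine ⟨fun h => ?_⟩
    rw [h, Nat.cast_zero, zero_div] at hγn
    exact hγ.not_gt hγn
  have hs : 0 < β + γ := by positivity
  have hp0 : 0 < p := by linarith
  have hp₂0 : 0 < p₂ := by linarith
  have hp₀0 : 0 < p₀ := by
    have h1 : 0 < (β + γ) / p₀ := by rw [hp₀]; positivity
    exact (div_pos_iff_of_pos_left hs).1 h1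
  have hη : 0 ≤ β / (β + γ) := by positivity
  obtain ⟨C, hC⟩ := exists_hardy_morreyNorm_le (n := n) hp hpq hγ hγn
  refine ⟨C ^ (β / (β + γ)), fun g hg hgc => ?_⟩
  have hgm : Measurable g := hg.continuous.measurable
  -- `γ < n / q` already forces `n ≠ 0`, so the origin, where the weights take junk values, is null.
  have hholder := morreyNorm_le_mul_of_enorm_le (p := p) (q := q) (p₂ := p₂) (q₂ := q₂)
    (p₀ := p₀) (q₀ := q₀) (θ := γ / (β + γ)) (η := β / (β + γ)) (f := g)
    (u := fun x => ((‖x‖ ^ β : ℝ) : ℂ) * g x) (v := fun x => ((‖x‖ ^ (-γ) : ℝ) : ℂ) * g x)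
    hp0 hp₂0 hp₀0 (by positivity) hη
    (by
      have : 1 / p₀ = (β + γ) / p₀ / (β + γ) := by field_simp
      rw [this, hp₀]; ring)
    (by
      have : 1 / q₀ = (β + γ) / q₀ / (β + γ) := by field_simp
      rw [this, hq₀]; ring)
    (by fun_prop) (by fun_prop) (by
      filter_upwards [ae_ne_zero] with x hx
      have hρ := norm_pos_iff.2 hx
      have e : ∀ t : ℝ, ‖((‖x‖ ^ t : ℝ) : ℂ)‖ₑ = ENNReal.ofReal (‖x‖ ^ t) := fun t => by
        rw [← ofReal_norm, Complex.norm_real, Real.norm_of_nonneg (by positivity)]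
      have hw : ENNReal.ofReal (‖x‖ ^ β) ^ (γ / (β + γ)) *
          ENNReal.ofReal (‖x‖ ^ (-γ)) ^ (β / (β + γ)) = 1 := by
        rw [ENNReal.ofReal_rpow_of_nonneg (by positivity) (by positivity),
          ENNReal.ofReal_rpow_of_nonneg (by positivity) hη, ← ENNReal.ofReal_mul (by positivity),
          ← Real.rpow_mul hρ.le, ← Real.rpow_mul hρ.le, ← Real.rpow_add hρ]
        have : β * (γ / (β + γ)) + -γ * (β / (β + γ)) = 0 := by ring
        rw [this, Real.rpow_zero, ENNReal.ofReal_one]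
      have hg1 : ‖g x‖ₑ ^ (γ / (β + γ)) * ‖g x‖ₑ ^ (β / (β + γ)) = ‖g x‖ₑ := by
        rw [← ENNReal.rpow_add_of_nonneg _ _ (by positivity) hη, ← add_div, add_comm γ,
          div_self hs.ne', ENNReal.rpow_one]
      simp only [enorm_mul, e]
      rw [ENNReal.mul_rpow_of_nonneg _ _ (by positivity), ENNReal.mul_rpow_of_nonneg _ _ hη,
        mul_mul_mul_comm, hw, hg1, one_mul])
  refine hholder.trans ((mul_le_mul_right (ENNReal.rpow_le_rpow (hC g hg hgc) hη) _).trans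
    (le_of_eq ?_))
  rw [ENNReal.mul_rpow_of_nonneg _ _ hη, ENNReal.coe_rpow_of_nonneg _ hη]
  ring
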